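/- Let $\Omega\subset\mathbb{R}^2$ be a bounded convex domain, let $S\subsetneq\partial\Omega$ have positive one-dimensional Hausdorff measure, let $u_0\in H^1(\Omega)$, and let $K=\{v\in H^1(\Omega): v|_S=u_0|_S\}$, where the boundary values are understood in the sense of traces (equality almost everywhere on $S$ with respect to arc length). Let $Q:\overline\Omega\to\mathbb{R}^+$ be measurable with $0<m\le Q(x)\le M<\infty$ for almost every $x$, let $\lambda_1>\lambda_2>0$, and put $\lambda(t)=\lambda_1$ for $t>0$ and $\lambda(t)=\lambda_2$ for $t\le 0$. Let $\varphi_1\in C^{1,1}(\mathbb{R})$ satisfy $\varphi_1(t)=\lambda_1^2$ for $t\ge 1$, $\varphi_1(t)=\lambda_2^2$ for $t\le 0$, and $\varphi_1'\ge 0$; for $\varepsilon>0$ put $\varphi_\varepsilon(t)=\varphi_1(t/\varepsilon)$. For $v\in K$ define $$J[v]=\int_\Omega\left(|\nabla v|^2+Q^2(x)\lambda^2(v)\right)dx,\qquad J_\varepsilon[v]=\int_\Omega\left(|\nabla v|^2+Q^2(x)\varphi_\varepsilon(v)\right)dx .$$ For every $\varepsilon>0$ let $u_\varepsilon\in K$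 be a minimizer of $J_\varepsilon$ over $K$, and let $(\delta_n)$ be any sequence of positive numbers with $\delta_n\to 0$. Then there exist $u\in K$ minimizing $J$ over $K$ and a subsequence $(\varepsilon_k)=(\delta_{n_k})$ such that $J_\varepsilon[u_\varepsilon]\to J[u]=\min_K J$ as $\varepsilon\to 0^+$ and $u_{\varepsilon_k}\to u$ strongly in $H^1(\Omega)$. -/

import Mathlib

open MeasureTheory Filter Topology Set
open scoped ContDiff ENNReal

noncomputable section

/-- The Euclidean plane. -/
abbrev Plane : Type := EuclideanSpace ℝ (Fin 2)

/-- `G` is the weak gradient of `v` in the open set `Ω`: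
`∫_Ω v ∂ₑφ = - ∫_Ω (G · e) φ` for every `φ ∈ C_c^∞(Ω)` and every vector `e`. -/
def IsWeakGradient (Ω : Set Plane) (v : Plane → ℝ) (G : Plane → Plane) : Prop :=
  ∀ φ : Plane → ℝ, ContDiff ℝ ∞ φ → HasCompactSupport φ → tsupport φ ⊆ Ω → ∀ e : Plane,
    ∫ x in Ω, v x * fderiv ℝ φ x e = -∫ x in Ω, inner ℝ (G x) e * φ x

theorem integrable_mul_test {Ω : Set Plane} {f g : Plane → ℝ}
    (hf : MemLp f 2 (volume.restrict Ω)) (hg : Continuous g) (hgc : HasCompactSupport g) :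
    Integrable (fun x => f x * g x) (volume.restrict Ω) := by
  have hg2 : MemLp g 2 (volume.restrict Ω) :=
    (hg.memLp_of_hasCompactSupport (p := 2) (μ := volume) hgc).restrict Ω
  exact hf.integrable_mul hg2

theorem continuous_fderiv_test {φ : Plane → ℝ} (hφ : ContDiff ℝ ∞ φ) (e : Plane) :
    Continuous (fun x => fderiv ℝ φ x e) :=
  (hφ.continuous_fderiv (by simp)).clm_apply continuous_const

theorem hasCompactSupport_fderiv_test {φ : Plane → ℝ} (hc : HasCompactSupport φ) (e : Plane) :
    HasCompactSupport (fun x => fderiv ℝ φ x e) :=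
  hc.fderiv_apply ℝ e

/-- The Sobolev space `H¹(Ω)`: the pairs `(v, ∇v)` in `L²(Ω) × L²(Ω; ℝ²)` whose second component is
the weak gradient of the first. As a subspace of the Hilbert sum it carries the norm
`(‖v‖²_{L²} + ‖∇v‖²_{L²})^{1/2}`. -/
def H1 (Ω : Set Plane) :
    Submodule ℝ
      (WithLp 2 (Lp ℝ 2 (volume.restrict Ω) × Lp Plane 2 (volume.restrict Ω))) where
  carrier := {p | IsWeakGradient Ω p.fst p.snd}
  zero_mem' := by
    intro φ _ _ _ e
    have h1 : ∫ x in Ω, ((0 : Lp ℝ 2 (volume.restrict Ω)) : Plane → ℝ) x * fderiv ℝ φ x e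
        = ∫ _x in Ω, (0 : ℝ) := by
      refine integral_congr_ae ?_
      filter_upwards [Lp.coeFn_zero ℝ 2 (volume.restrict Ω)] with x hx
      rw [hx]
      simp
    have h2 : ∫ x in Ω, inner ℝ (((0 : Lp Plane 2 (volume.restrict Ω)) : Plane → Plane) x) e * φ x
        = ∫ _x in Ω, (0 : ℝ) := by
      refine integral_congr_ae ?_
      filter_upwards [Lp.coeFn_zero Plane 2 (volume.restrict Ω)] with x hx
      rw [hx]
      simp
    refine h1.trans ?_
    refine Eq.trans ?_ (congrArg Neg.neg h2.symm)
    simp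
  add_mem' := by
    intro p q hp hq φ hφ hc hs e
    have h1 : ∫ x in Ω, (p + q).fst x * fderiv ℝ φ x e
        = (∫ x in Ω, p.fst x * fderiv ℝ φ x e) + ∫ x in Ω, q.fst x * fderiv ℝ φ x e := by
      rw [← integral_add
        (integrable_mul_test (Lp.memLp p.fst) (continuous_fderiv_test hφ e)
          (hasCompactSupport_fderiv_test hc e))
        (integrable_mul_test (Lp.memLp q.fst) (continuous_fderiv_test hφ e)
          (hasCompactSupport_fderiv_test hc e))]
      refine integral_congr_ae ?_
      filter_upwards [Lp.coeFn_add p.fst q.fst] with x hx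
      rw [WithLp.add_fst, hx]
      simp [add_mul]
    have h2 : ∫ x in Ω, inner ℝ ((p + q).snd x) e * φ x
        = (∫ x in Ω, inner ℝ (p.snd x) e * φ x) + ∫ x in Ω, inner ℝ (q.snd x) e * φ x := by
      rw [← integral_add
        (integrable_mul_test ((Lp.memLp p.snd).inner_const e) hφ.continuous hc)
        (integrable_mul_test ((Lp.memLp q.snd).inner_const e) hφ.continuous hc)]
      refine integral_congr_ae ?_
      filter_upwards [Lp.coeFn_add p.snd q.snd] with x hx
      rw [WithLp.add_snd, hx]
      simp [add_mul, inner_add_left]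
    rw [h1, h2, hp φ hφ hc hs e, hq φ hφ hc hs e]
    ring
  smul_mem' := by
    intro c p hp φ hφ hc hs e
    have h1 : ∫ x in Ω, (c • p).fst x * fderiv ℝ φ x e
        = c * ∫ x in Ω, p.fst x * fderiv ℝ φ x e := by
      rw [← integral_const_mul]
      refine integral_congr_ae ?_
      filter_upwards [Lp.coeFn_smul c p.fst] with x hx
      rw [WithLp.smul_fst, hx]
      simp [mul_assoc]
    have h2 : ∫ x in Ω, inner ℝ ((c • p).snd x) e * φ x
        = c * ∫ x in Ω, inner ℝ (p.snd x) e * φ x := by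
      rw [← integral_const_mul]
      refine integral_congr_ae ?_
      filter_upwards [Lp.coeFn_smul c p.snd] with x hx
      rw [WithLp.smul_snd, hx]
      simp [mul_assoc, real_inner_smul_left]
    rw [h1, h2, hp φ hφ hc hs e]
    ring

/-- The function underlying an element of `H¹(Ω)`. -/
def H1.fn {Ω : Set Plane} (v : H1 Ω) : Lp ℝ 2 (volume.restrict Ω) := v.1.fst

/-- The weak gradient of an element of `H¹(Ω)`. -/
def H1.grad {Ω : Set Plane} (v : H1 Ω) : Lp Plane 2 (volume.restrict Ω) := v.1.snd

/-- `g` is the trace of `v ∈ H¹(Ω)` on `∂Ω`: the pair `(v, g)` is a limit of `(ψₙ, ψₙ|_{∂Ω})` in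
`H¹(Ω) × L²(∂Ω)`, with `ψₙ` smooth up to the boundary. Here `∂Ω` carries the one-dimensional
Hausdorff measure (arc length). -/
def IsTrace (Ω : Set Plane) (v : H1 Ω) (g : Plane → ℝ) : Prop :=
  MemLp g 2 ((μH[1] : Measure Plane).restrict (frontier Ω)) ∧
  ∃ ψ : ℕ → Plane → ℝ, (∀ n, ContDiff ℝ ∞ (ψ n)) ∧
    Tendsto (fun n => eLpNorm (fun x => ψ n x - H1.fn v x) 2 (volume.restrict Ω)) atTop (𝓝 0) ∧
    Tendsto (fun n => eLpNorm (fun x => gradient (ψ n) x - H1.grad v x) 2 (volume.restrict Ω))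
      atTop (𝓝 0) ∧
    Tendsto (fun n => eLpNorm (fun x => ψ n x - g x) 2
      ((μH[1] : Measure Plane).restrict (frontier Ω))) atTop (𝓝 0)

/-- The admissible set `K = {v ∈ H¹(Ω) : v = u₀ on S}`, in the sense of traces: the traces
of `v` and `u₀` agree at almost every point of `S` with respect to arc length. -/
def admissible (Ω S : Set Plane) (u₀ : H1 Ω) : Set (H1 Ω) :=
  {v | ∃ g g₀ : Plane → ℝ, IsTrace Ω v g ∧ IsTrace Ω u₀ g₀ ∧
    ∀ᵐ x ∂(μH[1] : Measure Plane).restrict S, g x = g₀ x}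

/-- The phase function: `lam₁` for positive arguments and `lam₂` otherwise. -/
def phase (lam₁ lam₂ : ℝ) (t : ℝ) : ℝ := if 0 < t then lam₁ else lam₂

/-- The functional `J[v] = ∫_Ω (|∇v|² + Q² λ²(v))`. -/
def energy (Ω : Set Plane) (Q : Plane → ℝ) (lam₁ lam₂ : ℝ) (v : H1 Ω) : ℝ :=
  ∫ x in Ω, (‖H1.grad v x‖ ^ 2 + Q x ^ 2 * phase lam₁ lam₂ (H1.fn v x) ^ 2)

/-- The relaxed functional `J_ε[v] = ∫_Ω (|∇v|² + Q² φ_ε(v))` with `φ_ε(t) = φ₁(t / ε)`. -/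
def relaxedEnergy (Ω : Set Plane) (Q : Plane → ℝ) (φ₁ : ℝ → ℝ) (ε : ℝ) (v : H1 Ω) : ℝ :=
  ∫ x in Ω, (‖H1.grad v x‖ ^ 2 + Q x ^ 2 * φ₁ (H1.fn v x / ε))

/-- A `C^{1,1}` monotone transition layer of unit width from `lam₂²` to `lam₁²`. -/
structure IsTransitionLayer (lam₁ lam₂ : ℝ) (φ₁ : ℝ → ℝ) : Prop where
  contDiff : ContDiff ℝ 1 φ₁
  lipschitz_deriv : ∃ L : NNReal, LipschitzWith L (deriv φ₁)
  eq_of_one_le : ∀ t, 1 ≤ t → φ₁ t = lam₁ ^ 2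
  eq_of_nonpos : ∀ t, t ≤ 0 → φ₁ t = lam₂ ^ 2
  deriv_nonneg : ∀ t, 0 ≤ deriv φ₁ t

/-- `u` minimizes the functional `F` over the set `K`. -/
def IsMinimizer {X : Type*} (F : X → ℝ) (K : Set X) (u : X) : Prop :=
  u ∈ K ∧ ∀ v ∈ K, F u ≤ F v

end

/-!
Write `X = L²(Ω) × L²(Ω; ℝ²)`. The relaxed phase satisfies `φ_ε ≤ λ²`, so `J_ε ≤ J`, and `J_ε[u_ε]` is
antitone in `ε` and bounded above by `J[w]` for every admissible `w`. In particular the gradients of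
the `u_ε` are bounded in `L²`.

Compactness rests on two inequalities for smooth functions on a bounded convex domain. The Poincaré
inequality `measureReal_mul_integral_sq_le`, whose constant depends only on the diameter, is obtained
by integrating along segments; applied to the cells of a grid it gives Rellich's theorem
`exists_subseq_tendsto_fst`. The trace inequality `exists_trace_bound` is obtained by integrating along
the rays from an interior point. Traces are defined by approximation with smooth functions, so both
inequalities pass to the closed graph `traceGraph`. Together they give the Friedrichs inequality
`exists_norm_fst_le_norm_snd` for functions vanishing on `S`, hence boundedness of the `u_ε` in
`H¹(Ω)`, and show that the admissible set is closed and convex.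

A subsequence of `u_{δ_n}` therefore converges in `L²(Ω)` and almost everywhere, and the norms of the
gradients converge to some `ℓ`. A minimal-norm argument in closed convex hulls of tails
(`exists_mem_closure_convexHull_tails`) produces an admissible limit `u` with `‖∇u‖ ≤ ℓ`, to which the
subsequence converges strongly as soon as `‖∇u‖ = ℓ`. The lower limit of the potential terms is at
least `∫ Q² λ²(u)`, whence `ℓ² + ∫ Q² λ²(u) ≤ J[w]` for every admissible `w`. Thus `u` minimizes `J`,
the choice `w = u` gives `‖∇u‖ = ℓ`, and monotonicity in `ε` yields convergence of all the energies.
-/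

/-! ### Minimal-norm points in convex hulls of tails -/

/-- A bounded sequence in a Hilbert space has a point `c` in the closed convex hull of every tail
such that convergence of the norms to `‖c‖` forces strong convergence to `c`. The point is the limit
of the minimal-norm elements of the hulls, so no weak topology is needed. -/
theorem exists_mem_closure_convexHull_tails {H : Type*} [NormedAddCommGroup H]
    [InnerProductSpace ℝ H] [CompleteSpace H] (x : ℕ → H) {B : ℝ} (hx : ∀ k, ‖x k‖ ≤ B) :
    ∃ c, (∀ k, c ∈ closure (convexHull ℝ (x '' Ici k))) ∧
      (Tendsto (fun k => ‖x k‖) atTop (𝓝 ‖c‖) → Tendsto x atTop (𝓝 c)) := by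
  set C : ℕ → Set H := fun k => closure (convexHull ℝ (x '' Ici k)) with hC
  have hxC : ∀ k, x k ∈ C k := fun k =>
    subset_closure (subset_convexHull ℝ _ (mem_image_of_mem x (mem_Ici.2 le_rfl)))
  have hCanti : ∀ k l, k ≤ l → C l ⊆ C k := fun k l hkl =>
    closure_mono (convexHull_mono (image_mono (Ici_subset_Ici.2 hkl)))
  have hCconv : ∀ k, Convex ℝ (C k) := fun k => (convex_convexHull ℝ _).closure
  have key : ∀ k, ∃ c ∈ C k, ∀ w ∈ C k, ‖w - c‖ ^ 2 ≤ ‖w‖ ^ 2 - ‖c‖ ^ 2 := by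
    intro k
    obtain ⟨c, hc, hmin⟩ := exists_norm_eq_iInf_of_complete_convex ⟨x k, hxC k⟩
      isClosed_closure.isComplete (hCconv k) 0
    refine ⟨c, hc, fun w hw => ?_⟩
    have h := (norm_eq_iInf_iff_real_inner_le_zero (hCconv k) hc).1 hmin w hw
    rw [zero_sub, inner_neg_left, inner_sub_right, real_inner_self_eq_norm_sq,
      real_inner_comm] at h
    rw [norm_sub_sq_real]
    linarith
  choose c hcC hc using key
  have hle : ∀ k l, k ≤ l → ‖c l - c k‖ ^ 2 ≤ ‖c l‖ ^ 2 - ‖c k‖ ^ 2 := fun k l hkl =>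
    hc k _ (hCanti k l hkl (hcC l))
  have hmono : Monotone fun k => ‖c k‖ ^ 2 := fun k l hkl => by
    have := hle k l hkl
    have := sq_nonneg ‖c l - c k‖
    simp only
    linarith
  have hbdd : ∀ k, ‖c k‖ ^ 2 ≤ B ^ 2 := fun k => by
    have h1 := hc k _ (hxC k)
    have h2 := sq_nonneg ‖x k - c k‖
    have h3 : ‖x k‖ ^ 2 ≤ B ^ 2 := pow_le_pow_left₀ (norm_nonneg _) (hx k) 2
    linarith
  have hbdd' : BddAbove (range fun k => ‖c k‖ ^ 2) := ⟨B ^ 2, by rintro _ ⟨k, rfl⟩; exact hbdd k⟩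
  set L := ⨆ k, ‖c k‖ ^ 2
  have hL : Tendsto (fun k => ‖c k‖ ^ 2) atTop (𝓝 L) := tendsto_atTop_ciSup hmono hbdd'
  have hcauchy : CauchySeq c := by
    refine cauchySeq_of_le_tendsto_0' (fun k => √(L - ‖c k‖ ^ 2)) (fun k l hkl => ?_) ?_
    · rw [dist_comm, dist_eq_norm]
      refine Real.le_sqrt_of_sq_le ((hle k l hkl).trans ?_)
      have := le_ciSup hbdd' l
      exact sub_le_sub_right this _
    · have : Tendsto (fun k => √(L - ‖c k‖ ^ 2)) atTop (𝓝 √(L - L)) :=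
        (tendsto_const_nhds.sub hL).sqrt
      simpa using this
  obtain ⟨a, ha⟩ := cauchySeq_tendsto_of_complete hcauchy
  refine ⟨a, fun k => isClosed_closure.mem_of_tendsto ha ?_, fun hn => ?_⟩
  · filter_upwards [eventually_ge_atTop k] with l hl using hCanti k l hl (hcC l)
  · have h0 : Tendsto (fun k => ‖x k - c k‖) atTop (𝓝 0) := by
      have h1 : Tendsto (fun k => √(‖x k‖ ^ 2 - ‖c k‖ ^ 2)) atTop
          (𝓝 √(‖a‖ ^ 2 - ‖a‖ ^ 2)) := ((hn.pow 2).sub (ha.norm.pow 2)).sqrt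
      rw [sub_self, Real.sqrt_zero] at h1
      exact squeeze_zero (fun _ => norm_nonneg _)
        (fun k => Real.le_sqrt_of_sq_le (hc k _ (hxC k))) h1
    have := (tendsto_zero_iff_norm_tendsto_zero.2 h0).add ha
    simpa using this

theorem mem_of_mem_closure_convexHull_tails {E : Type*} [NormedAddCommGroup E] [NormedSpace ℝ E]
    {x : ℕ → E} {c : E} (hc : ∀ k, c ∈ closure (convexHull ℝ (x '' Ici k))) {Z : Set E}
    (hZ : IsClosed Z) (hZc : Convex ℝ Z) (hx : ∀ᶠ k in atTop, x k ∈ Z) : c ∈ Z := by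
  obtain ⟨k, hk⟩ := eventually_atTop.1 hx
  refine closure_minimal (convexHull_min ?_ hZc) hZ (hc k)
  rintro _ ⟨j, hj, rfl⟩
  exact hk j hj

/-! ### The Poincaré inequality on convex sets -/

theorem continuous_gradient {ψ : Plane → ℝ} (hψ : ContDiff ℝ 1 ψ) : Continuous (gradient ψ) :=
  (InnerProductSpace.toDual ℝ Plane).symm.continuous.comp (hψ.continuous_fderiv one_ne_zero)

theorem sq_sub_le_integral_gradient_segment {ψ : Plane → ℝ} (hψ : ContDiff ℝ 1 ψ) (x y : Plane) :
    (ψ y - ψ x) ^ 2 ≤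
      ‖y - x‖ ^ 2 * ∫ t in (0 : ℝ)..1, ‖gradient ψ (x + t • (y - x))‖ ^ 2 := by
  have hline : ∀ t : ℝ, HasDerivAt (fun t : ℝ => x + t • (y - x)) (y - x) t := fun t => by
    simpa using ((hasDerivAt_id t).smul_const (y - x)).const_add x
  have hd : ∀ t : ℝ, HasDerivAt (fun t : ℝ => ψ (x + t • (y - x)))
      (inner ℝ (gradient ψ (x + t • (y - x))) (y - x)) t := fun t => by
    rw [inner_gradient_left]
    exact ((hψ.differentiable one_ne_zero _).hasFDerivAt).comp_hasDerivAt t (hline t)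
  have hlc : Continuous fun t : ℝ => x + t • (y - x) := by fun_prop
  have hgc := continuous_gradient hψ
  have hg : Continuous fun t : ℝ => gradient ψ (x + t • (y - x)) := hgc.comp hlc
  have hic : Continuous fun t : ℝ => inner ℝ (gradient ψ (x + t • (y - x))) (y - x) :=
    hg.inner continuous_const
  have hftc : ∫ t in (0 : ℝ)..1, inner ℝ (gradient ψ (x + t • (y - x))) (y - x) = ψ y - ψ x := by
    rw [intervalIntegral.integral_eq_sub_of_hasDerivAt (fun t _ => hd t)
      (hic.intervalIntegrable _ _)]
    simp
  have hgn : Continuous fun t : ℝ => ‖gradient ψ (x + t • (y - x))‖ ^ 2 := hg.norm.pow 2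
  have hgn' : Continuous fun t : ℝ => ‖y - x‖ ^ 2 * ‖gradient ψ (x + t • (y - x))‖ ^ 2 :=
    continuous_const.mul hgn
  set c := ψ y - ψ x
  -- Integrating `2 c f ≤ c² + f²` over the unit interval replaces the Cauchy-Schwarz inequality.
  have hint : ∫ t in (0 : ℝ)..1, 2 * c * inner ℝ (gradient ψ (x + t • (y - x))) (y - x) ≤
      ∫ t in (0 : ℝ)..1, (c ^ 2 + ‖y - x‖ ^ 2 * ‖gradient ψ (x + t • (y - x))‖ ^ 2) := by
    refine intervalIntegral.integral_mono_on zero_le_one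
      ((continuous_const.mul hic).intervalIntegrable _ _)
      ((continuous_const.add hgn').intervalIntegrable _ _) fun t _ => ?_
    have h1 := abs_real_inner_le_norm (gradient ψ (x + t • (y - x))) (y - x)
    have h2 : (inner ℝ (gradient ψ (x + t • (y - x))) (y - x) : ℝ) ^ 2 ≤
        (‖gradient ψ (x + t • (y - x))‖ * ‖y - x‖) ^ 2 := by
      rw [← sq_abs]; exact pow_le_pow_left₀ (abs_nonneg _) h1 2
    nlinarith [sq_nonneg (c - inner ℝ (gradient ψ (x + t • (y - x))) (y - x))]
  rw [intervalIntegral.integral_const_mul, hftc, intervalIntegral.integral_add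
    (continuous_const.intervalIntegrable _ _)
    (hgn'.intervalIntegrable _ _),
    intervalIntegral.integral_const_mul] at hint
  simp only [intervalIntegral.integral_const, sub_zero, smul_eq_mul, one_mul] at hint
  nlinarith

/-- The factor `4` bounds the inverse Jacobian `a⁻²` of the homothety `x ↦ b + a • x`. -/
theorem lintegral_comp_smul_add_le {P : Set Plane} (hPm : MeasurableSet P) {G : Plane → ℝ≥0∞}
    {a : ℝ} (ha : 1 / 2 ≤ a) (b : Plane) (hmap : ∀ x ∈ P, b + a • x ∈ P) :
    ∫⁻ x in P, G (b + a • x) ≤ 4 * ∫⁻ x in P, G x := by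
  have ha0 : a ≠ 0 := by intro h; norm_num [h] at ha
  have hcoef : ENNReal.ofReal |(a ^ Module.finrank ℝ Plane)⁻¹| ≤ 4 := by
    have h2 : Module.finrank ℝ Plane = 2 := by simp
    rw [h2, abs_of_nonneg (by positivity), show (4 : ℝ≥0∞) = ENNReal.ofReal 4 by simp]
    refine ENNReal.ofReal_le_ofReal ?_
    rw [inv_le_comm₀ (by positivity) (by norm_num)]
    nlinarith
  set f := P.indicator G
  have hemb : MeasurableEmbedding fun x : Plane => a • x :=
    (Homeomorph.smulOfNeZero a ha0).measurableEmbedding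
  calc ∫⁻ x in P, G (b + a • x) ≤ ∫⁻ x, f (b + a • x) := by
        rw [← lintegral_indicator hPm]
        refine lintegral_mono fun x => ?_
        by_cases hx : x ∈ P
        · simp [f, hx, hmap x hx]
        · simp [hx]
    _ = ∫⁻ y, f (b + y) ∂(Measure.map (fun x : Plane => a • x) volume) := by
        rw [hemb.lintegral_map]
    _ = ENNReal.ofReal |(a ^ Module.finrank ℝ Plane)⁻¹| * ∫⁻ x, f x := by
        rw [show (fun x : Plane => a • x) = (a • ·) from rfl, Measure.map_addHaar_smul _ ha0,
          lintegral_smul_measure, lintegral_add_left_eq_self f b, smul_eq_mul]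
    _ ≤ 4 * ∫⁻ x in P, G x := by
        rw [lintegral_indicator hPm]
        gcongr

/-- The average of `G` over the points dividing the segments of a convex set in the ratio `t`. The
change of variables is made in the endpoint whose coefficient is at least `1 / 2`, which keeps the
constant independent of `t`. -/
theorem lintegral_lintegral_segment_le {P : Set Plane} (hPm : MeasurableSet P) (hPc : Convex ℝ P)
    {G : Plane → ℝ≥0∞} (hG : Measurable G) {t : ℝ} (ht0 : 0 ≤ t) (ht1 : t ≤ 1) :
    ∫⁻ x in P, ∫⁻ y in P, G (x + t • (y - x)) ≤ 4 * volume P * ∫⁻ x in P, G x := by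
  have hrw : ∀ x y : Plane, x + t • (y - x) = (1 - t) • x + t • y := fun x y => by module
  have hconv : ∀ x ∈ P, ∀ y ∈ P, (1 - t) • x + t • y ∈ P := fun x hx y hy =>
    hPc hx hy (by linarith) ht0 (by ring)
  simp_rw [hrw]
  have hconst : ∀ F : Plane → ℝ≥0∞, (∀ x ∈ P, F x ≤ 4 * ∫⁻ x in P, G x) →
      ∫⁻ x in P, F x ≤ 4 * volume P * ∫⁻ x in P, G x := fun F hF => by
    calc ∫⁻ x in P, F x ≤ ∫⁻ _ in P, 4 * ∫⁻ x in P, G x := setLIntegral_mono' hPm hF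
      _ = 4 * volume P * ∫⁻ x in P, G x := by rw [setLIntegral_const]; ring
  rcases le_total (1 / 2) t with h | h
  · exact hconst _ fun x hx => lintegral_comp_smul_add_le hPm h _ fun y hy => hconv x hx y hy
  · rw [lintegral_lintegral_swap (by fun_prop)]
    refine hconst _ fun y hy => ?_
    simp_rw [add_comm _ (t • y)]
    exact lintegral_comp_smul_add_le hPm (by linarith) _ fun x hx => by
      rw [add_comm]; exact hconv x hx y hy

theorem lintegral_lintegral_sq_sub_le {P : Set Plane} (hPm : MeasurableSet P) (hPc : Convex ℝ P)
    {h : ℝ} (hd : ∀ x ∈ P, ∀ y ∈ P, ‖y - x‖ ≤ h) {ψ : Plane → ℝ} (hψ : ContDiff ℝ 1 ψ) :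
    ∫⁻ x in P, ∫⁻ y in P, ENNReal.ofReal ((ψ y - ψ x) ^ 2) ≤
      ENNReal.ofReal (h ^ 2) *
        (4 * volume P * ∫⁻ x in P, ENNReal.ofReal (‖gradient ψ x‖ ^ 2)) := by
  have hgc := continuous_gradient hψ
  set G : Plane → ℝ≥0∞ := fun x => ENNReal.ofReal (‖gradient ψ x‖ ^ 2) with hGdef
  have hG : Measurable G := (ENNReal.continuous_ofReal.comp (hgc.norm.pow 2)).measurable
  have hpt : ∀ x ∈ P, ∀ y ∈ P, ENNReal.ofReal ((ψ y - ψ x) ^ 2) ≤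
      ENNReal.ofReal (h ^ 2) * ∫⁻ t in Ioc (0 : ℝ) 1, G (x + t • (y - x)) := by
    intro x hx y hy
    have hc : Continuous fun t : ℝ => ‖gradient ψ (x + t • (y - x))‖ ^ 2 := by fun_prop
    have h0 : 0 ≤ ∫ t in (0 : ℝ)..1, ‖gradient ψ (x + t • (y - x))‖ ^ 2 :=
      intervalIntegral.integral_nonneg zero_le_one fun t _ => by positivity
    rw [hGdef, ← ofReal_integral_eq_lintegral_ofReal (hc.intervalIntegrable 0 1).1
      (ae_of_all _ fun t => by positivity), ← intervalIntegral.integral_of_le zero_le_one,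
      ← ENNReal.ofReal_mul (by positivity)]
    refine ENNReal.ofReal_le_ofReal ((sq_sub_le_integral_gradient_segment hψ x y).trans ?_)
    gcongr
    exact hd x hx y hy
  calc ∫⁻ x in P, ∫⁻ y in P, ENNReal.ofReal ((ψ y - ψ x) ^ 2)
      ≤ ∫⁻ x in P, ∫⁻ y in P,
          ENNReal.ofReal (h ^ 2) * ∫⁻ t in Ioc (0 : ℝ) 1, G (x + t • (y - x)) :=
        setLIntegral_mono' hPm fun x hx => setLIntegral_mono' hPm fun y hy => hpt x hx y hy
    _ = ENNReal.ofReal (h ^ 2) * ∫⁻ x in P, ∫⁻ y in P, ∫⁻ t in Ioc (0 : ℝ) 1,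
          G (x + t • (y - x)) := by
        rw [← lintegral_const_mul' _ _ ENNReal.ofReal_ne_top]
        refine lintegral_congr fun x => ?_
        rw [lintegral_const_mul' _ _ ENNReal.ofReal_ne_top]
    _ = ENNReal.ofReal (h ^ 2) * ∫⁻ t in Ioc (0 : ℝ) 1, ∫⁻ x in P, ∫⁻ y in P,
          G (x + t • (y - x)) := by
        congr 1
        have hin : ∀ x, ∫⁻ y in P, ∫⁻ t in Ioc (0 : ℝ) 1, G (x + t • (y - x)) =
            ∫⁻ t in Ioc (0 : ℝ) 1, ∫⁻ y in P, G (x + t • (y - x)) := fun x =>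
          lintegral_lintegral_swap (hG.comp (by fun_prop : Continuous fun p : Plane × ℝ =>
            x + p.2 • (p.1 - x)).measurable).aemeasurable
        simp_rw [hin]
        refine lintegral_lintegral_swap ?_
        have : Measurable fun q : (Plane × ℝ) × Plane => G (q.1.1 + q.1.2 • (q.2 - q.1.1)) :=
          hG.comp (by fun_prop : Continuous fun q : (Plane × ℝ) × Plane =>
            q.1.1 + q.1.2 • (q.2 - q.1.1)).measurable
        exact this.lintegral_prod_right'.aemeasurable
    _ ≤ ENNReal.ofReal (h ^ 2) * ∫⁻ t in Ioc (0 : ℝ) 1, 4 * volume P * ∫⁻ x in P, G x := by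
        refine mul_le_mul_right ?_ _
        exact setLIntegral_mono' measurableSet_Ioc fun t ht =>
          lintegral_lintegral_segment_le hPm hPc hG ht.1.le ht.2
    _ = _ := by simp

theorem Continuous.integrableOn_of_isBounded {E : Type*} [NormedAddCommGroup E] {f : Plane → E}
    (hf : Continuous f) {P : Set Plane} (hPb : Bornology.IsBounded P) :
    IntegrableOn f P :=
  (hf.continuousOn.integrableOn_compact hPb.isCompact_closure).mono_set subset_closure

/-- The Poincaré inequality on a convex set, with a constant that depends on the diameter only. It
follows from expanding the double integral of `(ψ y - ψ x) ^ 2`; multiplying through by the area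
avoids excluding null sets. -/
theorem measureReal_mul_integral_sq_le {P : Set Plane} (hPm : MeasurableSet P)
    (hPc : Convex ℝ P) (hPb : Bornology.IsBounded P) {h : ℝ}
    (hd : ∀ x ∈ P, ∀ y ∈ P, ‖y - x‖ ≤ h) {ψ : Plane → ℝ} (hψ : ContDiff ℝ 1 ψ) :
    volume.real P * ∫ x in P, ψ x ^ 2 ≤
      (∫ x in P, ψ x) ^ 2 + 2 * h ^ 2 * volume.real P * ∫ x in P, ‖gradient ψ x‖ ^ 2 := by
  have hψc := hψ.continuous
  have hgc := continuous_gradient hψ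
  have hfin : volume P ≠ ⊤ := hPb.measure_lt_top.ne
  have i1 : Integrable ψ (volume.restrict P) := hψc.integrableOn_of_isBounded hPb
  have i2 : Integrable (fun x => ψ x ^ 2) (volume.restrict P) :=
    (hψc.pow 2).integrableOn_of_isBounded hPb
  have i0 : ∀ c : ℝ, Integrable (fun _ : Plane => c) (volume.restrict P) := fun c =>
    (continuous_const : Continuous fun _ : Plane => c).integrableOn_of_isBounded hPb
  have ig : Integrable (fun x => ‖gradient ψ x‖ ^ 2) (volume.restrict P) :=
    (hgc.norm.pow 2).integrableOn_of_isBounded hPb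
  set I := ∫ x in P, ψ x with hI
  set J := ∫ x in P, ψ x ^ 2 with hJ
  have hin : ∀ x, ∫ y in P, (ψ y - ψ x) ^ 2 = J - 2 * I * ψ x + volume.real P * ψ x ^ 2 := by
    intro x
    have : ∀ y, (ψ y - ψ x) ^ 2 = (ψ y ^ 2 - (2 * ψ x) * ψ y) + ψ x ^ 2 := fun y => by ring
    simp_rw [this]
    have i3 : Integrable (fun y => ψ y ^ 2 - 2 * ψ x * ψ y) (volume.restrict P) :=
      i2.sub (i1.const_mul _)
    rw [integral_add i3 (i0 _), integral_sub i2 (i1.const_mul _),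
      integral_const_mul, setIntegral_const, smul_eq_mul]
    ring
  have hout : ∫ x in P, ∫ y in P, (ψ y - ψ x) ^ 2 = 2 * volume.real P * J - 2 * I ^ 2 := by
    simp_rw [hin]
    have i3 : Integrable (fun x => J - 2 * I * ψ x) (volume.restrict P) :=
      (i0 _).sub (i1.const_mul _)
    rw [integral_add i3 (i2.const_mul _),
      integral_sub (i0 _) (i1.const_mul _), integral_const_mul, integral_const_mul,
      setIntegral_const, smul_eq_mul]
    ring
  have hlin : ∫⁻ x in P, ∫⁻ y in P, ENNReal.ofReal ((ψ y - ψ x) ^ 2) =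
      ENNReal.ofReal (∫ x in P, ∫ y in P, (ψ y - ψ x) ^ 2) := by
    rw [ofReal_integral_eq_lintegral_ofReal]
    · refine lintegral_congr fun x => ?_
      rw [ofReal_integral_eq_lintegral_ofReal]
      · exact (by fun_prop : Continuous fun y => (ψ y - ψ x) ^ 2).integrableOn_of_isBounded hPb
      · exact ae_of_all _ fun y => sq_nonneg _
    · simp_rw [hin]
      exact ((i0 _).sub (i1.const_mul _)).add (i2.const_mul _)
    · exact ae_of_all _ fun x => integral_nonneg fun y => sq_nonneg _
  have hmain := lintegral_lintegral_sq_sub_le hPm hPc hd hψ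
  have hg0 : 0 ≤ ∫ x in P, ‖gradient ψ x‖ ^ 2 := integral_nonneg fun x => by positivity
  rw [hlin, hout, ← ofReal_integral_eq_lintegral_ofReal ig (ae_of_all _ fun x => by positivity),
    ← ENNReal.ofReal_toReal hfin, show (4 : ℝ≥0∞) = ENNReal.ofReal 4 by simp,
    ← ENNReal.ofReal_mul (by norm_num), ← ENNReal.ofReal_mul (by positivity),
    ← ENNReal.ofReal_mul (by positivity),
    ENNReal.ofReal_le_ofReal_iff (by positivity)] at hmain
  rw [Measure.real] at *
  linarith

/-! ### Polar coordinates and boundary values on a convex domain -/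

/-- The unit vector of the plane with polar angle `θ`. -/
noncomputable def polarVec (θ : ℝ) : Plane := !₂[Real.cos θ, Real.sin θ]

theorem norm_polarVec (θ : ℝ) : ‖polarVec θ‖ = 1 := by
  simp [polarVec, EuclideanSpace.norm_eq, Fin.sum_univ_two]

theorem norm_polarVec_sub_le (θ η : ℝ) : ‖polarVec θ - polarVec η‖ ≤ |θ - η| := by
  refine le_of_sq_le_sq ?_ (abs_nonneg _)
  rw [EuclideanSpace.norm_sq_eq, sq_abs]
  simp only [polarVec, Fin.sum_univ_two, PiLp.sub_apply, Real.norm_eq_abs, sq_abs]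
  have h1 := Real.one_sub_sq_div_two_le_cos (x := θ - η)
  rw [Real.cos_sub] at h1
  have h2 := Real.sin_sq_add_cos_sq θ
  have h3 := Real.sin_sq_add_cos_sq η
  simp
  nlinarith

theorem exists_eq_norm_smul_polarVec (x : Plane) :
    ∃ θ ∈ Ioc (-Real.pi) Real.pi, x = ‖x‖ • polarVec θ := by
  refine ⟨Complex.arg ⟨x 0, x 1⟩, Complex.arg_mem_Ioc _, ?_⟩
  have hn : ‖x‖ = ‖(⟨x 0, x 1⟩ : ℂ)‖ := by
    rw [EuclideanSpace.norm_eq, Complex.norm_def, Complex.normSq_apply, Fin.sum_univ_two]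
    simp [sq]
  ext i
  rw [hn]
  fin_cases i
  · simp [polarVec, Complex.norm_mul_cos_arg]
  · simp [polarVec, Complex.norm_mul_sin_arg]

theorem lintegral_polar {f : Plane → ℝ≥0∞} (hf : Measurable f) :
    ∫⁻ θ in Ioo (-Real.pi) Real.pi, ∫⁻ t in Ioi (0 : ℝ), ENNReal.ofReal t * f (t • polarVec θ) =
      ∫⁻ x, f x := by
  have hmp : MeasurePreserving (fun p : ℝ × ℝ => (!₂[p.1, p.2] : Plane)) :=
    (PiLp.volume_preserving_toLp (Fin 2)).comp (volume_preserving_finTwoArrow ℝ).symm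
  rw [← hmp.lintegral_comp hf, ← lintegral_comp_polarCoord_symm, polarCoord_target,
    Measure.volume_eq_prod, ← Measure.prod_restrict, lintegral_prod_symm']
  · refine lintegral_congr fun θ => lintegral_congr fun t => ?_
    rw [smul_eq_mul]
    congr 2
    ext i
    fin_cases i <;> simp [polarVec]
  · have : Continuous fun p : ℝ × ℝ => polarCoord.symm p := continuous_polarCoord_symm
    simp only [smul_eq_mul]
    exact (by fun_prop : Measurable fun p : ℝ × ℝ => ENNReal.ofReal p.1).mul
      (hf.comp (hmp.measurable.comp this.measurable))

/-- A boundary value is controlled along the ray by an integral with the weight `t dt` of polar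
coordinates. -/
theorem sq_le_integral_radial {ψ : Plane → ℝ} (hψ : ContDiff ℝ 1 ψ) (x₀ : Plane) {e : Plane}
    (he : ‖e‖ = 1) {r ρ : ℝ} (hr : 0 < r) (hρ : r ≤ ρ) :
    ψ (x₀ + ρ • e) ^ 2 ≤ ∫ t in (0 : ℝ)..ρ,
      t * ((2 / r ^ 2 + 1 / r) * (ψ (x₀ + t • e) ^ 2 + ‖gradient ψ (x₀ + t • e)‖ ^ 2)) := by
  have hρ0 : 0 < ρ := hr.trans_le hρ
  have hψc := hψ.continuous
  have hgc := continuous_gradient hψ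
  have hline : ∀ t : ℝ, HasDerivAt (fun t : ℝ => x₀ + t • e) e t := fun t => by
    simpa using ((hasDerivAt_id t).smul_const e).const_add x₀
  have hd : ∀ t : ℝ, HasDerivAt (fun t : ℝ => ψ (x₀ + t • e))
      (inner ℝ (gradient ψ (x₀ + t • e)) e) t := fun t => by
    rw [inner_gradient_left]
    exact ((hψ.differentiable one_ne_zero _).hasFDerivAt).comp_hasDerivAt t (hline t)
  -- The weight `(t / ρ)²` vanishes at the centre and produces the factor `t` of the area element.
  have hd2 : ∀ t : ℝ, HasDerivAt (fun t : ℝ => (t / ρ) ^ 2 * ψ (x₀ + t • e) ^ 2)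
      (2 * t / ρ ^ 2 * ψ (x₀ + t • e) ^ 2 +
        (t / ρ) ^ 2 * (2 * ψ (x₀ + t • e) * inner ℝ (gradient ψ (x₀ + t • e)) e)) t := fun t => by
    have h := ((((hasDerivAt_id t).div_const ρ).pow 2).mul ((hd t).pow 2))
    refine h.congr_deriv ?_
    simp only [Pi.pow_apply, id, Nat.cast_ofNat, Nat.add_one_sub_one, pow_one]
    ring
  have hftc := intervalIntegral.integral_eq_sub_of_hasDerivAt (a := 0) (b := ρ)
    (fun t _ => hd2 t) (Continuous.intervalIntegrable (by fun_prop) _ _)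
  have hval : ψ (x₀ + ρ • e) ^ 2 = ∫ t in (0 : ℝ)..ρ, (2 * t / ρ ^ 2 * ψ (x₀ + t • e) ^ 2 +
        (t / ρ) ^ 2 * (2 * ψ (x₀ + t • e) * inner ℝ (gradient ψ (x₀ + t • e)) e)) := by
    rw [hftc, div_self hρ0.ne']
    simp
  rw [hval]
  refine intervalIntegral.integral_mono_on hρ0.le (Continuous.intervalIntegrable (by fun_prop) _ _)
    (Continuous.intervalIntegrable (by fun_prop) _ _) fun t ht => ?_
  set a := ψ (x₀ + t • e)
  set b := gradient ψ (x₀ + t • e)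
  have hb : |inner ℝ b e| ≤ ‖b‖ := by simpa [he] using abs_real_inner_le_norm b e
  have hb2 : (inner ℝ b e : ℝ) ^ 2 ≤ ‖b‖ ^ 2 := by
    rw [← sq_abs]; exact pow_le_pow_left₀ (abs_nonneg _) hb 2
  have h1 : 2 * t / ρ ^ 2 * a ^ 2 ≤ t * (2 / r ^ 2 * (a ^ 2 + ‖b‖ ^ 2)) := by
    calc 2 * t / ρ ^ 2 * a ^ 2 = t * (2 / ρ ^ 2 * a ^ 2) := by ring
      _ ≤ t * (2 / r ^ 2 * (a ^ 2 + ‖b‖ ^ 2)) := by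
        refine mul_le_mul_of_nonneg_left ?_ ht.1
        gcongr
        exact le_add_of_nonneg_right (by positivity)
  have h2 : (t / ρ) ^ 2 * (2 * a * inner ℝ b e) ≤ t * (1 / r * (a ^ 2 + ‖b‖ ^ 2)) := by
    calc (t / ρ) ^ 2 * (2 * a * inner ℝ b e) ≤ (t / ρ) ^ 2 * (a ^ 2 + ‖b‖ ^ 2) := by
          gcongr
          nlinarith [sq_nonneg (a - inner ℝ b e)]
      _ = t * (t / ρ * (1 / ρ)) * (a ^ 2 + ‖b‖ ^ 2) := by ring
      _ ≤ t * (1 * (1 / r)) * (a ^ 2 + ‖b‖ ^ 2) := by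
          have := ht.1
          gcongr
          exact (div_le_one hρ0).2 ht.2
      _ = _ := by ring
  linarith

/-- A bounded convex domain is star-shaped about an interior point with a radial function `ρ` that
is bounded below and makes the radial parametrization of the boundary Lipschitz. -/
theorem exists_radial_parametrization {Ω : Set Plane} (hΩo : IsOpen Ω)
    (hΩb : Bornology.IsBounded Ω) (hΩc : Convex ℝ Ω) (hΩn : Ω.Nonempty) :
    ∃ (x₀ : Plane) (ρ : ℝ → ℝ) (r : ℝ) (L : NNReal), 0 < r ∧ (∀ θ, r ≤ ρ θ) ∧
      (∀ θ t, 0 ≤ t → t < ρ θ → x₀ + t • polarVec θ ∈ Ω) ∧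
      LipschitzWith L (fun θ => x₀ + ρ θ • polarVec θ) ∧
      ∀ x ∈ frontier Ω, ∃ θ ∈ Ioc (-Real.pi) Real.pi, x₀ + ρ θ • polarVec θ = x := by
  obtain ⟨x₀, hx₀⟩ := hΩn
  set A : Set Plane := (fun y => x₀ + y) ⁻¹' Ω with hA
  have hAo : IsOpen A := hΩo.preimage (by fun_prop)
  have hAc : Convex ℝ A := hΩc.translate_preimage_right x₀
  have h0A : (0 : Plane) ∈ A := by simpa [hA] using hx₀
  have hA0 : A ∈ 𝓝 (0 : Plane) := hAo.mem_nhds h0A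
  have habs : Absorbent ℝ A := absorbent_nhds_zero hA0
  have hAfr : ∀ x, x ∈ frontier Ω → x - x₀ ∈ frontier A := fun x hx => by
    have : frontier A = (Homeomorph.addLeft x₀) ⁻¹' frontier Ω :=
      ((Homeomorph.addLeft x₀).preimage_frontier Ω).symm
    rw [this]
    simpa using hx
  obtain ⟨r, hr, hrA⟩ := Metric.mem_nhds_iff.1 hA0
  obtain ⟨R, hR, hRΩ⟩ := hΩb.subset_closedBall_lt 0 x₀
  have hRA : A ⊆ Metric.closedBall 0 R := fun y hy => by
    have := hRΩ hy
    simpa [dist_eq_norm] using this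
  set g := gauge A
  have hg1 : ∀ θ, r * g (polarVec θ) ≤ 1 := fun θ => by
    simpa [norm_polarVec] using mul_gauge_le_norm (x := polarVec θ) hrA
  have hg2 : ∀ θ, 1 / R ≤ g (polarVec θ) := fun θ => by
    simpa [norm_polarVec] using le_gauge_of_subset_closedBall (x := polarVec θ) habs hR.le hRA
  have hgpos : ∀ θ, 0 < g (polarVec θ) := fun θ => (by positivity : 0 < 1 / R).trans_le (hg2 θ)
  have hρR : ∀ θ, (g (polarVec θ))⁻¹ ≤ R := fun θ => by
    rw [inv_le_comm₀ (hgpos θ) hR]; simpa using hg2 θ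
  have hgsmul : ∀ t : ℝ, 0 ≤ t → ∀ x, g (t • x) = t * g x := fun t ht x =>
    gauge_smul_of_nonneg ht x
  have hglip : ∀ θ η, |g (polarVec θ) - g (polarVec η)| ≤ r⁻¹ * |θ - η| := fun θ η => by
    have h := (hAc.lipschitzWith_gauge (r := r.toNNReal) (Real.toNNReal_pos.2 hr)
      (by rwa [Real.coe_toNNReal r hr.le])).dist_le_mul (polarVec θ) (polarVec η)
    rw [Real.dist_eq, dist_eq_norm, NNReal.coe_inv, Real.coe_toNNReal r hr.le] at h
    refine h.trans ?_
    gcongr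
    exact norm_polarVec_sub_le θ η
  refine ⟨x₀, fun θ => (g (polarVec θ))⁻¹, r, (R * R * r⁻¹ + R).toNNReal, hr,
    fun θ => ?_, fun θ t ht0 ht => ?_, LipschitzWith.of_dist_le_mul fun θ η => ?_, fun x hx => ?_⟩
  · rw [le_inv_comm₀ hr (hgpos θ), ← one_div, le_div_iff₀ hr, mul_comm]
    exact hg1 θ
  · have h1 : g (t • polarVec θ) < 1 := by
      rw [hgsmul t ht0]
      have ht' : t < (g (polarVec θ))⁻¹ := ht
      rwa [← one_div, lt_div_iff₀ (hgpos θ)] at ht'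
    exact interior_subset (s := A) ((gauge_lt_one_iff_mem_interior hAc hA0).1 h1)
  · simp only [dist_add_left]
    rw [dist_eq_norm, Real.dist_eq]
    have hsplit : (g (polarVec θ))⁻¹ • polarVec θ - (g (polarVec η))⁻¹ • polarVec η =
        ((g (polarVec θ))⁻¹ - (g (polarVec η))⁻¹) • polarVec θ +
          (g (polarVec η))⁻¹ • (polarVec θ - polarVec η) := by module
    have hinv : |(g (polarVec θ))⁻¹ - (g (polarVec η))⁻¹| ≤ R * R * (r⁻¹ * |θ - η|) := by
      rw [inv_sub_inv (hgpos θ).ne' (hgpos η).ne', abs_div, div_eq_mul_inv, mul_comm, abs_mul,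
        mul_inv, abs_of_pos (hgpos θ), abs_of_pos (hgpos η), abs_sub_comm]
      have := hgpos θ
      have := hgpos η
      gcongr
      · exact hρR θ
      · exact hρR η
      · exact hglip θ η
    rw [hsplit]
    refine (norm_add_le _ _).trans ?_
    rw [norm_smul, norm_smul, norm_polarVec, Real.norm_eq_abs, Real.norm_eq_abs, mul_one,
      abs_of_pos (inv_pos.2 (hgpos η))]
    rw [Real.coe_toNNReal _ (by positivity)]
    have h2 : (g (polarVec η))⁻¹ * ‖polarVec θ - polarVec η‖ ≤ R * |θ - η| := by
      gcongr
      · exact hρR η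
      · exact norm_polarVec_sub_le θ η
    linarith
  · obtain ⟨θ, hθ, hxθ⟩ := exists_eq_norm_smul_polarVec (x - x₀)
    refine ⟨θ, hθ, ?_⟩
    have h1 : g (x - x₀) = 1 := (gauge_eq_one_iff_mem_frontier hAc hA0).2 (hAfr x hx)
    have h2 : ‖x - x₀‖ * g (polarVec θ) = 1 := by
      rwa [hxθ, hgsmul _ (norm_nonneg _)] at h1
    have h3 : (g (polarVec θ))⁻¹ = ‖x - x₀‖ := by
      rw [inv_eq_iff_eq_inv]; exact eq_inv_of_mul_eq_one_right h2
    simp only [h3, ← hxθ, add_sub_cancel]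

/-- The trace inequality for smooth functions on a bounded convex domain. Arc length on the boundary
is dominated by a multiple of the image of `dθ` under the Lipschitz radial parametrization, and the
radial estimate is integrated in polar coordinates. -/
theorem exists_trace_bound {Ω : Set Plane} (hΩo : IsOpen Ω)
    (hΩb : Bornology.IsBounded Ω) (hΩc : Convex ℝ Ω) (hΩn : Ω.Nonempty) :
    (μH[1] : Measure Plane) (frontier Ω) < ⊤ ∧ ∃ C : NNReal, ∀ ψ : Plane → ℝ, ContDiff ℝ 1 ψ →
      ∫⁻ x in frontier Ω, ENNReal.ofReal (ψ x ^ 2) ∂(μH[1] : Measure Plane) ≤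
        C * ∫⁻ x in Ω, ENNReal.ofReal (ψ x ^ 2 + ‖gradient ψ x‖ ^ 2) := by
  obtain ⟨x₀, ρ, r, L, hr, hρ, hmem, hlip, hsurj⟩ :=
    exists_radial_parametrization hΩo hΩb hΩc hΩn
  set Φ : ℝ → Plane := fun θ => x₀ + ρ θ • polarVec θ with hΦ
  have hcover : ∀ E : Set Plane, (μH[1] : Measure Plane) (E ∩ frontier Ω) ≤
      L * volume (Φ ⁻¹' E ∩ Ioc (-Real.pi) Real.pi) := fun E => by
    have hsub : E ∩ frontier Ω ⊆ Φ '' (Φ ⁻¹' E ∩ Ioc (-Real.pi) Real.pi) := by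
      rintro x ⟨hxE, hx⟩
      obtain ⟨θ, hθ, rfl⟩ := hsurj x hx
      exact ⟨θ, ⟨hxE, hθ⟩, rfl⟩
    refine (measure_mono hsub).trans ?_
    have h := hlip.hausdorffMeasure_image_le zero_le_one (Φ ⁻¹' E ∩ Ioc (-Real.pi) Real.pi)
    rwa [hausdorffMeasure_real, ENNReal.rpow_one] at h
  refine ⟨?_, L * (2 / r ^ 2 + 1 / r).toNNReal, fun ψ hψ => ?_⟩
  · have h := hcover univ
    rw [univ_inter, preimage_univ, univ_inter, Real.volume_Ioc] at h
    exact h.trans_lt (ENNReal.mul_lt_top ENNReal.coe_lt_top ENNReal.ofReal_lt_top)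
  have hψc := hψ.continuous
  have hgc := continuous_gradient hψ
  set c : ℝ := 2 / r ^ 2 + 1 / r with hc
  have hc0 : 0 ≤ c := by positivity
  set F : Plane → ℝ := fun x => ψ x ^ 2 + ‖gradient ψ x‖ ^ 2 with hF
  have hFc : Continuous F := by fun_prop
  have hF0 : ∀ x, 0 ≤ F x := fun x => by positivity
  have hμ : (μH[1] : Measure Plane).restrict (frontier Ω) ≤
      (L : ℝ≥0∞) • Measure.map Φ (volume.restrict (Ioo (-Real.pi) Real.pi)) := by
    refine Measure.le_iff.2 fun E hE => ?_
    rw [Measure.restrict_apply hE, Measure.smul_apply, smul_eq_mul,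
      Measure.map_apply hlip.continuous.measurable hE, restrict_Ioo_eq_restrict_Ioc,
      Measure.restrict_apply (hlip.continuous.measurable hE)]
    exact hcover E
  have hmeas : Measurable fun x => ENNReal.ofReal (ψ x ^ 2) :=
    (ENNReal.continuous_ofReal.comp (hψc.pow 2)).measurable
  set f : Plane → ℝ≥0∞ := (Ω.indicator fun x => ENNReal.ofReal (F x)) with hf
  have hfm : Measurable f :=
    ((ENNReal.continuous_ofReal.comp hFc).measurable).indicator hΩo.measurableSet
  have hray : ∀ θ, ENNReal.ofReal (ψ (Φ θ) ^ 2) ≤ ENNReal.ofReal c *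
      ∫⁻ t in Ioi (0 : ℝ), ENNReal.ofReal t * f (x₀ + t • polarVec θ) := by
    intro θ
    have hρ0 : 0 ≤ ρ θ := hr.le.trans (hρ θ)
    have hcont : Continuous fun t : ℝ => t * (c * F (x₀ + t • polarVec θ)) := by fun_prop
    refine (ENNReal.ofReal_le_ofReal
      (sq_le_integral_radial hψ x₀ (norm_polarVec θ) hr (hρ θ))).trans ?_
    rw [intervalIntegral.integral_of_le hρ0, ← restrict_Ioo_eq_restrict_Ioc,
      ofReal_integral_eq_lintegral_ofReal, ← lintegral_const_mul' _ _ ENNReal.ofReal_ne_top]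
    · refine (setLIntegral_mono' measurableSet_Ioo fun t ht => ?_).trans
        (lintegral_mono_set Ioo_subset_Ioi_self)
      rw [hf, indicator_of_mem (hmem θ t ht.1.le ht.2), ENNReal.ofReal_mul ht.1.le,
        ENNReal.ofReal_mul hc0]
      exact (mul_left_comm _ _ _).le
    · exact (hcont.intervalIntegrable 0 (ρ θ)).1.mono_set Ioo_subset_Ioc_self
    · refine (ae_restrict_iff' measurableSet_Ioo).2 (ae_of_all _ fun t ht => ?_)
      exact mul_nonneg ht.1.le (mul_nonneg hc0 (hF0 _))
  calc ∫⁻ x in frontier Ω, ENNReal.ofReal (ψ x ^ 2) ∂(μH[1] : Measure Plane)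
      ≤ ∫⁻ x, ENNReal.ofReal (ψ x ^ 2)
          ∂((L : ℝ≥0∞) • Measure.map Φ (volume.restrict (Ioo (-Real.pi) Real.pi))) :=
        lintegral_mono' hμ le_rfl
    _ = L * ∫⁻ θ in Ioo (-Real.pi) Real.pi, ENNReal.ofReal (ψ (Φ θ) ^ 2) := by
        rw [lintegral_smul_measure, lintegral_map hmeas hlip.continuous.measurable, smul_eq_mul]
    _ ≤ L * ∫⁻ θ in Ioo (-Real.pi) Real.pi, ENNReal.ofReal c *
          ∫⁻ t in Ioi (0 : ℝ), ENNReal.ofReal t * f (x₀ + t • polarVec θ) := by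
        gcongr with θ
        exact hray θ
    _ = L * (ENNReal.ofReal c * ∫⁻ x, f (x₀ + x)) := by
        rw [lintegral_const_mul' _ _ ENNReal.ofReal_ne_top,
          lintegral_polar (f := fun x => f (x₀ + x)) (hfm.comp (by fun_prop))]
    _ = _ := by
        rw [lintegral_add_left_eq_self f x₀, hf, lintegral_indicator hΩo.measurableSet,
          ENNReal.coe_mul, mul_assoc]
        rfl

/-! ### The graph of the trace -/

/-- The Hilbert space `L²(Ω) × L²(Ω; ℝ²)` of which `H¹(Ω)` is a subspace. -/
abbrev JetSpace (Ω : Set Plane) : Type :=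
  WithLp 2 (Lp ℝ 2 (volume.restrict Ω) × Lp Plane 2 (volume.restrict Ω))

/-- The space `L²(∂Ω)` with respect to arc length. -/
abbrev BoundaryL2 (Ω : Set Plane) : Type :=
  Lp ℝ 2 ((μH[1] : Measure Plane).restrict (frontier Ω))

theorem memLp_restrict_of_continuous {E : Type*} [NormedAddCommGroup E]
    [SecondCountableTopology E] {f : Plane → E}
    (hf : Continuous f) {ν : Measure Plane} {s : Set Plane} (hs : MeasurableSet s)
    (hb : Bornology.IsBounded s) (hν : ν s < ⊤) : MemLp f 2 (ν.restrict s) := by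
  have : IsFiniteMeasure (ν.restrict s) := ⟨by simpa using hν⟩
  obtain ⟨C, hC⟩ := hb.isCompact_closure.exists_bound_of_continuousOn hf.continuousOn
  refine MemLp.of_bound hf.aestronglyMeasurable C ((ae_restrict_iff' hs).2 (ae_of_all _ ?_))
  exact fun x hx => hC x (subset_closure hx)

theorem L2_norm_sq_eq_integral {α E : Type*} [MeasurableSpace α] {μ : Measure α}
    [NormedAddCommGroup E] [InnerProductSpace ℝ E] (f : Lp E 2 μ) :
    ‖f‖ ^ 2 = ∫ x, ‖f x‖ ^ 2 ∂μ := by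
  rw [← real_inner_self_eq_norm_sq, L2.inner_def]
  simp

theorem continuous_gradient_of_smooth {ψ : Plane → ℝ} (hψ : ContDiff ℝ ∞ ψ) :
    Continuous (gradient ψ) :=
  continuous_gradient (hψ.of_le (by simp))

/-- The pairs `((ψ, ∇ψ), ψ|_{∂Ω})` for `ψ` smooth on the whole plane. -/
def smoothTraceGraph (Ω : Set Plane) : Submodule ℝ (JetSpace Ω × BoundaryL2 Ω) where
  carrier := {q | ∃ ψ : Plane → ℝ, ContDiff ℝ ∞ ψ ∧ q.1.fst =ᵐ[volume.restrict Ω] ψ ∧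
    q.1.snd =ᵐ[volume.restrict Ω] gradient ψ ∧
    q.2 =ᵐ[(μH[1] : Measure Plane).restrict (frontier Ω)] ψ}
  zero_mem' := by
    refine ⟨0, contDiff_const, Lp.coeFn_zero .., ?_, Lp.coeFn_zero ..⟩
    have : gradient (0 : Plane → ℝ) = 0 := by
      ext1 x; exact gradient_const (F := Plane) x 0
    rw [this]
    exact Lp.coeFn_zero ..
  add_mem' := by
    rintro p q ⟨ψ, hψ, h1, h2, h3⟩ ⟨η, hη, k1, k2, k3⟩
    refine ⟨ψ + η, hψ.add hη, ?_, ?_, ?_⟩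
    · exact (Lp.coeFn_add ..).trans (h1.add k1)
    · have : gradient (ψ + η) = gradient ψ + gradient η := by
        ext1 x
        simp only [gradient, Pi.add_apply]
        rw [fderiv_add (hψ.differentiable (by simp) x) (hη.differentiable (by simp) x), map_add]
      rw [this]
      exact (Lp.coeFn_add ..).trans (h2.add k2)
    · exact (Lp.coeFn_add ..).trans (h3.add k3)
  smul_mem' := by
    rintro c p ⟨ψ, hψ, h1, h2, h3⟩
    refine ⟨c • ψ, contDiff_const.smul hψ, ?_, ?_, ?_⟩
    · exact (Lp.coeFn_smul ..).trans (h1.const_smul c)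
    · have : gradient (c • ψ) = c • gradient ψ := by
        ext1 x
        simp only [gradient, Pi.smul_apply]
        rw [fderiv_const_smul (hψ.differentiable (by simp) x)]
        simp
      rw [this]
      exact (Lp.coeFn_smul ..).trans (h2.const_smul c)
    · exact (Lp.coeFn_smul ..).trans (h3.const_smul c)

/-- The graph of the trace relation between `H¹(Ω)` and `L²(∂Ω)`. -/
noncomputable def traceGraph (Ω : Set Plane) : Submodule ℝ (JetSpace Ω × BoundaryL2 Ω) :=
  (smoothTraceGraph Ω).topologicalClosure

/-- A closed property of smooth functions holds on the whole trace graph. -/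
theorem traceGraph_induction {Ω : Set Plane} {p : JetSpace Ω × BoundaryL2 Ω → Prop}
    (hp : IsClosed {q | p q}) (h : ∀ q ∈ smoothTraceGraph Ω, p q) :
    ∀ q ∈ traceGraph Ω, p q := fun q hq =>
  closure_minimal (show (smoothTraceGraph Ω : Set _) ⊆ {q | p q} from h) hp
    (by rwa [traceGraph, ← SetLike.mem_coe, Submodule.topologicalClosure_coe] at hq)

theorem tendsto_jetSpace_iff {Ω : Set Plane} {ι : Type*} {l : Filter ι} {p : ι → JetSpace Ω}
    {a : JetSpace Ω} : Tendsto p l (𝓝 a) ↔ Tendsto (fun i => (p i).fst) l (𝓝 a.fst) ∧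
      Tendsto (fun i => (p i).snd) l (𝓝 a.snd) := by
  constructor
  · intro h
    exact ⟨((WithLp.prod_continuous_ofLp 2 _ _).fst.tendsto a).comp h,
      ((WithLp.prod_continuous_ofLp 2 _ _).snd.tendsto a).comp h⟩
  · rintro ⟨h1, h2⟩
    exact ((WithLp.prod_continuous_toLp 2 _ _).tendsto (a.fst, a.snd)).comp
      (h1.prodMk_nhds h2)

theorem mem_traceGraph_of_isTrace {Ω : Set Plane} (hΩo : IsOpen Ω) (hΩb : Bornology.IsBounded Ω)
    (hfin : (μH[1] : Measure Plane) (frontier Ω) < ⊤) {v : H1 Ω} {g : Plane → ℝ}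
    (h : IsTrace Ω v g) : (v.1, h.1.toLp g) ∈ traceGraph Ω := by
  obtain ⟨hg, ψ, hψ, h1, h2, h3⟩ := h
  have hfb : Bornology.IsBounded (frontier Ω) := hΩb.closure.subset frontier_subset_closure
  have m1 : ∀ n, MemLp (ψ n) 2 (volume.restrict Ω) := fun n =>
    memLp_restrict_of_continuous (hψ n).continuous hΩo.measurableSet hΩb hΩb.measure_lt_top
  have m2 : ∀ n, MemLp (gradient (ψ n)) 2 (volume.restrict Ω) := fun n =>
    memLp_restrict_of_continuous (continuous_gradient_of_smooth (hψ n)) hΩo.measurableSet hΩb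
      hΩb.measure_lt_top
  have m3 : ∀ n, MemLp (ψ n) 2 ((μH[1] : Measure Plane).restrict (frontier Ω)) := fun n =>
    memLp_restrict_of_continuous (hψ n).continuous isClosed_frontier.measurableSet hfb hfin
  set q : ℕ → JetSpace Ω × BoundaryL2 Ω := fun n =>
    (WithLp.toLp 2 ((m1 n).toLp _, (m2 n).toLp _), (m3 n).toLp _) with hq
  rw [traceGraph, ← SetLike.mem_coe, Submodule.topologicalClosure_coe]
  refine mem_closure_of_tendsto (f := q) (b := atTop) ?_ (Eventually.of_forall fun n =>
    ⟨ψ n, hψ n, (m1 n).coeFn_toLp, (m2 n).coeFn_toLp, (m3 n).coeFn_toLp⟩)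
  refine Tendsto.prodMk_nhds (tendsto_jetSpace_iff.2 ⟨?_, ?_⟩) ?_
  · rw [Lp.tendsto_Lp_iff_tendsto_eLpNorm']
    refine h1.congr fun n => eLpNorm_congr_ae ?_
    filter_upwards [(m1 n).coeFn_toLp] with x hx
    exact congrArg (· - H1.fn v x) hx.symm
  · rw [Lp.tendsto_Lp_iff_tendsto_eLpNorm']
    refine h2.congr fun n => eLpNorm_congr_ae ?_
    filter_upwards [(m2 n).coeFn_toLp] with x hx
    exact congrArg (· - H1.grad v x) hx.symm
  · rw [Lp.tendsto_Lp_iff_tendsto_eLpNorm']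
    refine h3.congr fun n => eLpNorm_congr_ae ?_
    filter_upwards [(m3 n).coeFn_toLp, hg.coeFn_toLp] with x hx hx'
    simp only [Pi.sub_apply]
    rw [hx, hx']

theorem isTrace_of_mem_traceGraph {Ω : Set Plane} {v : H1 Ω} {g : BoundaryL2 Ω}
    (h : (v.1, g) ∈ traceGraph Ω) : IsTrace Ω v g := by
  rw [traceGraph, ← SetLike.mem_coe, Submodule.topologicalClosure_coe,
    mem_closure_iff_seq_limit] at h
  obtain ⟨q, hq, hlim⟩ := h
  choose ψ hψ e1 e2 e3 using hq
  rw [nhds_prod_eq, tendsto_prod_iff'] at hlim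
  obtain ⟨l1, l2⟩ := tendsto_jetSpace_iff.1 hlim.1
  have l3 := hlim.2
  rw [Lp.tendsto_Lp_iff_tendsto_eLpNorm'] at l1 l2 l3
  refine ⟨Lp.memLp g, ψ, hψ, ?_, ?_, ?_⟩
  · refine l1.congr fun n => eLpNorm_congr_ae ?_
    filter_upwards [e1 n] with x hx
    exact congrArg (· - H1.fn v x) hx
  · refine l2.congr fun n => eLpNorm_congr_ae ?_
    filter_upwards [e2 n] with x hx
    exact congrArg (· - H1.grad v x) hx
  · refine l3.congr fun n => eLpNorm_congr_ae ?_
    filter_upwards [e3 n] with x hx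
    exact congrArg (· - g x) hx

/-! ### Trace and Poincaré inequalities in the Sobolev space -/

theorem jetSpace_norm_sq {Ω : Set Plane} (p : JetSpace Ω) :
    ‖p‖ ^ 2 = ‖p.fst‖ ^ 2 + ‖p.snd‖ ^ 2 :=
  WithLp.prod_norm_sq_eq_of_L2 p

theorem norm_jetSpace_fst_le {Ω : Set Plane} (p : JetSpace Ω) : ‖p.fst‖ ≤ ‖p‖ := by
  refine le_of_sq_le_sq ?_ (norm_nonneg _)
  rw [jetSpace_norm_sq]
  exact le_add_of_nonneg_right (sq_nonneg _)

theorem norm_jetSpace_snd_le {Ω : Set Plane} (p : JetSpace Ω) : ‖p.snd‖ ≤ ‖p‖ := by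
  refine le_of_sq_le_sq ?_ (norm_nonneg _)
  rw [jetSpace_norm_sq]
  exact le_add_of_nonneg_left (sq_nonneg _)

theorem continuous_jetSpace_fst {Ω : Set Plane} : Continuous fun p : JetSpace Ω => p.fst :=
  (WithLp.prod_continuous_ofLp 2 _ _).fst

theorem continuous_jetSpace_snd {Ω : Set Plane} : Continuous fun p : JetSpace Ω => p.snd :=
  (WithLp.prod_continuous_ofLp 2 _ _).snd

/-- The trace inequality, extended by density to the trace graph. -/
theorem exists_norm_trace_le {Ω : Set Plane} (hΩo : IsOpen Ω)
    (hΩb : Bornology.IsBounded Ω) (hΩc : Convex ℝ Ω) (hΩn : Ω.Nonempty) :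
    ∃ C : ℝ, 0 ≤ C ∧ ∀ q ∈ traceGraph Ω, ‖q.2‖ ≤ C * ‖q.1‖ := by
  obtain ⟨-, C, hC⟩ := exists_trace_bound hΩo hΩb hΩc hΩn
  refine ⟨√C, Real.sqrt_nonneg _, traceGraph_induction
    (isClosed_le continuous_snd.norm (continuous_const.mul continuous_fst.norm)) ?_⟩
  rintro q ⟨ψ, hψ, e1, e2, e3⟩
  have hψ1 : ContDiff ℝ 1 ψ := hψ.of_le (by simp)
  have hψc := hψ.continuous
  have hgc := continuous_gradient hψ1
  have h := hC ψ hψ1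
  have n1 : ‖q.2‖ ^ 2 = ∫ x in frontier Ω, ψ x ^ 2 ∂(μH[1] : Measure Plane) := by
    rw [L2_norm_sq_eq_integral]
    refine integral_congr_ae ?_
    filter_upwards [e3] with x hx
    rw [hx, Real.norm_eq_abs, sq_abs]
  have n2 : ‖q.1.fst‖ ^ 2 = ∫ x in Ω, ψ x ^ 2 := by
    rw [L2_norm_sq_eq_integral]
    refine integral_congr_ae ?_
    filter_upwards [e1] with x hx
    rw [hx, Real.norm_eq_abs, sq_abs]
  have n3 : ‖q.1.snd‖ ^ 2 = ∫ x in Ω, ‖gradient ψ x‖ ^ 2 := by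
    rw [L2_norm_sq_eq_integral]
    refine integral_congr_ae ?_
    filter_upwards [e2] with x hx
    rw [hx]
  have i1 : Integrable (fun x => ψ x ^ 2) (volume.restrict Ω) :=
    (hψc.pow 2).integrableOn_of_isBounded hΩb
  have i2 : Integrable (fun x => ‖gradient ψ x‖ ^ 2) (volume.restrict Ω) :=
    (hgc.norm.pow 2).integrableOn_of_isBounded hΩb
  have i3 : Integrable (fun x => ψ x ^ 2) ((μH[1] : Measure Plane).restrict (frontier Ω)) := by
    have hm : MemLp ψ 2 ((μH[1] : Measure Plane).restrict (frontier Ω)) :=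
      (memLp_congr_ae e3).1 (Lp.memLp q.2)
    exact hm.integrable_sq
  have i4 : Integrable (fun x => ψ x ^ 2 + ‖gradient ψ x‖ ^ 2) (volume.restrict Ω) := i1.add i2
  have n4 : ‖q.1‖ ^ 2 = ∫ x in Ω, (ψ x ^ 2 + ‖gradient ψ x‖ ^ 2) := by
    rw [jetSpace_norm_sq, n2, n3, integral_add i1 i2]
  rw [← ofReal_integral_eq_lintegral_ofReal i3 (ae_of_all _ fun x => sq_nonneg _),
    ← ofReal_integral_eq_lintegral_ofReal i4 (ae_of_all _ fun x => by positivity),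
    ← n1, ← n4, ← ENNReal.ofReal_coe_nnreal, ← ENNReal.ofReal_mul C.coe_nonneg,
    ENNReal.ofReal_le_ofReal_iff (by positivity)] at h
  refine le_of_sq_le_sq ?_ (by positivity)
  rw [mul_pow, Real.sq_sqrt C.coe_nonneg]
  exact h

theorem continuous_setIntegral_L2 {μ : Measure Plane} [IsFiniteMeasure μ] {s : Set Plane}
    (hs : MeasurableSet s) :
    Continuous fun f : Lp ℝ 2 μ => ∫ x in s, f x ∂μ := by
  have : (fun f : Lp ℝ 2 μ => ∫ x in s, f x ∂μ) =
      fun f => inner ℝ (indicatorConstLp 2 hs (measure_ne_top μ s) (1 : ℝ)) f := by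
    ext1 f
    rw [L2.inner_indicatorConstLp_one]
  rw [this]
  exact continuous_const.inner continuous_id

/-- The Poincaré inequality with mean values, applied on each of finitely many convex cells. -/
theorem norm_fst_sq_le_sum_cells {Ω : Set Plane} (hΩo : IsOpen Ω) (hΩb : Bornology.IsBounded Ω)
    (hΩc : Convex ℝ Ω) {ι : Type*} (F : Finset ι) {cell : ι → Set Plane}
    (hm : ∀ k, MeasurableSet (cell k)) (hc : ∀ k, Convex ℝ (cell k))
    (hdisj : Pairwise (Function.onFun Disjoint cell)) {h : ℝ}
    (hd : ∀ k ∈ F, ∀ x ∈ cell k ∩ Ω, ∀ y ∈ cell k ∩ Ω, ‖y - x‖ ≤ h)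
    (hcov : Ω ⊆ ⋃ k ∈ F, cell k) :
    ∀ q ∈ traceGraph Ω, ‖q.1.fst‖ ^ 2 ≤
      ∑ k ∈ F, (volume.real (cell k ∩ Ω))⁻¹ *
        (∫ x in cell k, q.1.fst x ∂(volume.restrict Ω)) ^ 2 + 2 * h ^ 2 * ‖q.1.snd‖ ^ 2 := by
  have : IsFiniteMeasure (volume.restrict Ω) := ⟨by simpa using hΩb.measure_lt_top⟩
  refine traceGraph_induction (isClosed_le ?_ ?_) ?_
  · exact (continuous_jetSpace_fst.comp continuous_fst).norm.pow 2
  · refine (continuous_finsetSum _ fun k _ => continuous_const.mul ?_).add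
      (continuous_const.mul ((continuous_jetSpace_snd.comp continuous_fst).norm.pow 2))
    exact ((continuous_setIntegral_L2 (hm k)).comp
      (continuous_jetSpace_fst.comp continuous_fst)).pow 2
  rintro q ⟨ψ, hψ, e1, e2, -⟩
  have hψ1 : ContDiff ℝ 1 ψ := hψ.of_le (by simp)
  have hψc := hψ.continuous
  have hgc := continuous_gradient hψ1
  have n2 : ‖q.1.fst‖ ^ 2 = ∫ x in Ω, ψ x ^ 2 := by
    rw [L2_norm_sq_eq_integral]
    refine integral_congr_ae ?_
    filter_upwards [e1] with x hx
    rw [hx, Real.norm_eq_abs, sq_abs]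
  have n3 : ‖q.1.snd‖ ^ 2 = ∫ x in Ω, ‖gradient ψ x‖ ^ 2 := by
    rw [L2_norm_sq_eq_integral]
    refine integral_congr_ae ?_
    filter_upwards [e2] with x hx
    rw [hx]
  have hΩeq : Ω = ⋃ k ∈ F, cell k ∩ Ω := by
    rw [← iUnion₂_inter, inter_eq_right.2 hcov]
  have hsplit : ∀ f : Plane → ℝ, Continuous f →
      ∫ x in Ω, f x = ∑ k ∈ F, ∫ x in cell k ∩ Ω, f x := fun f hf => by
    conv_lhs => rw [hΩeq]
    refine integral_biUnion_finset F (fun k _ => (hm k).inter hΩo.measurableSet) ?_ ?_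
    · exact fun i _ j _ hij => (hdisj hij).mono inter_subset_left inter_subset_left
    · exact fun k _ => hf.integrableOn_of_isBounded (hΩb.subset inter_subset_right)
  have n1 : ∀ k, ∫ x in cell k, q.1.fst x ∂(volume.restrict Ω) = ∫ x in cell k ∩ Ω, ψ x := by
    intro k
    rw [← Measure.restrict_restrict (hm k)]
    exact integral_congr_ae (ae_restrict_of_ae e1)
  simp_rw [n1]
  rw [n2, n3, hsplit (fun x => ψ x ^ 2) (hψc.pow 2),
    hsplit (fun x => ‖gradient ψ x‖ ^ 2) (hgc.norm.pow 2), Finset.mul_sum,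
    ← Finset.sum_add_distrib]
  refine Finset.sum_le_sum fun k hk => ?_
  have hfin : volume (cell k ∩ Ω) ≠ ⊤ := (hΩb.subset inter_subset_right).measure_lt_top.ne
  have hp := measureReal_mul_integral_sq_le ((hm k).inter hΩo.measurableSet)
    ((hc k).inter hΩc) (hΩb.subset inter_subset_right) (hd k hk) hψ1
  have hg0 : 0 ≤ ∫ x in cell k ∩ Ω, ‖gradient ψ x‖ ^ 2 := integral_nonneg fun x => by positivity
  rcases (measureReal_nonneg : 0 ≤ volume.real (cell k ∩ Ω)).eq_or_lt with h0 | h0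
  · have : volume.restrict (cell k ∩ Ω) = 0 :=
      Measure.restrict_eq_zero.2 ((measureReal_eq_zero_iff hfin).1 h0.symm)
    simp [this]
  · rw [← sub_nonneg] at hp ⊢
    have heq : volume.real (cell k ∩ Ω) * ((volume.real (cell k ∩ Ω))⁻¹ *
        (∫ x in cell k ∩ Ω, ψ x) ^ 2 + 2 * h ^ 2 * (∫ x in cell k ∩ Ω, ‖gradient ψ x‖ ^ 2) -
          ∫ x in cell k ∩ Ω, ψ x ^ 2) =
        (∫ x in cell k ∩ Ω, ψ x) ^ 2 + 2 * h ^ 2 * volume.real (cell k ∩ Ω) *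
          (∫ x in cell k ∩ Ω, ‖gradient ψ x‖ ^ 2) -
            volume.real (cell k ∩ Ω) * ∫ x in cell k ∩ Ω, ψ x ^ 2 := by
      field_simp
    rw [← heq] at hp
    exact nonneg_of_mul_nonneg_right hp h0

/-- The half-open grid square with index `k` and side length `1 / (N + 1)`. -/
def gridCell (N : ℕ) (k : ℤ × ℤ) : Set Plane :=
  {x | ⌊x 0 * (N + 1)⌋ = k.1 ∧ ⌊x 1 * (N + 1)⌋ = k.2}

theorem mem_gridCell_iff {N : ℕ} {k : ℤ × ℤ} {x : Plane} : x ∈ gridCell N k ↔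
    x ∈ (fun x : Plane => x 0 * ((N : ℝ) + 1)) ⁻¹' Ico (k.1 : ℝ) (k.1 + 1) ∩
      (fun x : Plane => x 1 * ((N : ℝ) + 1)) ⁻¹' Ico (k.2 : ℝ) (k.2 + 1) := by
  simp [gridCell, Int.floor_eq_iff]

theorem measurableSet_gridCell (N : ℕ) (k : ℤ × ℤ) : MeasurableSet (gridCell N k) := by
  rw [Set.ext fun x => mem_gridCell_iff]
  exact ((by fun_prop : Continuous fun x : Plane => x 0 * ((N : ℝ) + 1)).measurable
    measurableSet_Ico).inter
    ((by fun_prop : Continuous fun x : Plane => x 1 * ((N : ℝ) + 1)).measurable measurableSet_Ico)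

theorem convex_gridCell (N : ℕ) (k : ℤ × ℤ) : Convex ℝ (gridCell N k) := by
  rw [Set.ext fun x => mem_gridCell_iff]
  have hl : ∀ i : Fin 2, IsLinearMap ℝ fun x : Plane => x i * ((N : ℝ) + 1) := fun i =>
    ⟨fun x y => by simp [add_mul], fun c x => by simp [mul_assoc]⟩
  exact ((convex_Ico _ _).is_linear_preimage (hl 0)).inter
    ((convex_Ico _ _).is_linear_preimage (hl 1))

theorem pairwise_disjoint_gridCell (N : ℕ) : Pairwise (Function.onFun Disjoint (gridCell N)) := by
  intro k l hkl
  refine disjoint_left.2 fun x hx hx' => hkl (Prod.ext ?_ ?_)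
  · exact hx.1.symm.trans hx'.1
  · exact hx.2.symm.trans hx'.2

theorem norm_sub_le_of_mem_gridCell {N : ℕ} {k : ℤ × ℤ} {x y : Plane} (hx : x ∈ gridCell N k)
    (hy : y ∈ gridCell N k) : ‖y - x‖ ≤ 2 / ((N : ℝ) + 1) := by
  rw [mem_gridCell_iff] at hx hy
  obtain ⟨⟨a1, a2⟩, b1, b2⟩ := hx
  obtain ⟨⟨c1, c2⟩, d1, d2⟩ := hy
  simp only at a1 a2 b1 b2 c1 c2 d1 d2
  have hN : (0 : ℝ) < N + 1 := by positivity
  rw [le_div_iff₀ hN]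
  refine le_of_sq_le_sq ?_ zero_le_two
  rw [mul_pow, EuclideanSpace.norm_sq_eq, Fin.sum_univ_two, add_mul]
  simp only [PiLp.sub_apply, Real.norm_eq_abs, sq_abs]
  nlinarith

theorem exists_finset_gridCell_cover {Ω : Set Plane} (hΩb : Bornology.IsBounded Ω) (N : ℕ) :
    ∃ F : Finset (ℤ × ℤ), Ω ⊆ ⋃ k ∈ F, gridCell N k := by
  obtain ⟨R, hR⟩ := hΩb.subset_closedBall 0
  refine ⟨Finset.Icc ⌊-R * (N + 1)⌋ ⌊R * (N + 1)⌋ ×ˢ Finset.Icc ⌊-R * (N + 1)⌋ ⌊R * (N + 1)⌋,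
    fun x hx => ?_⟩
  have hxR : ‖x‖ ≤ R := by simpa using hR hx
  have hN : (0 : ℝ) ≤ N + 1 := by positivity
  have hcoord : ∀ i, ⌊x i * (N + 1)⌋ ∈ Finset.Icc ⌊-R * (N + 1)⌋ ⌊R * ((N : ℝ) + 1)⌋ := by
    intro i
    have := abs_le.1 ((PiLp.norm_apply_le x i).trans hxR)
    exact Finset.mem_Icc.2 ⟨Int.floor_le_floor (mul_le_mul_of_nonneg_right this.1 hN),
      Int.floor_le_floor (mul_le_mul_of_nonneg_right this.2 hN)⟩
  simp only [mem_iUnion]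
  exact ⟨(⌊x 0 * (N + 1)⌋, ⌊x 1 * (N + 1)⌋), Finset.mem_product.2 ⟨hcoord 0, hcoord 1⟩, rfl, rfl⟩

/-! ### The Rellich and Friedrichs theorems -/

/-- The Rellich compactness theorem. By the Poincaré inequality on the cells of a fine grid, strong
convergence reduces to convergence of the countably many cell integrals, which compactness of a
product of intervals provides. -/
theorem exists_subseq_tendsto_fst {Ω : Set Plane} (hΩo : IsOpen Ω) (hΩb : Bornology.IsBounded Ω)
    (hΩc : Convex ℝ Ω) {q : ℕ → JetSpace Ω × BoundaryL2 Ω} (hq : ∀ n, q n ∈ traceGraph Ω)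
    {B : ℝ} (hB : ∀ n, ‖(q n).1‖ ≤ B) :
    ∃ φ : ℕ → ℕ, StrictMono φ ∧ ∃ f : Lp ℝ 2 (volume.restrict Ω),
      Tendsto (fun n => (q (φ n)).1.fst) atTop (𝓝 f) := by
  have : IsFiniteMeasure (volume.restrict Ω) := ⟨by simpa using hΩb.measure_lt_top⟩
  set a : ℕ → ℕ × (ℤ × ℤ) → ℝ := fun n j =>
    ∫ x in gridCell j.1 j.2, (q n).1.fst x ∂(volume.restrict Ω) with ha
  set c : ℕ × (ℤ × ℤ) → ℝ := fun j => ‖indicatorConstLp 2 (measurableSet_gridCell j.1 j.2)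
    (measure_ne_top (volume.restrict Ω) _) (1 : ℝ)‖ * B with hc
  have hac : ∀ n, a n ∈ univ.pi fun j => Icc (-c j) (c j) := by
    intro n j _
    refine abs_le.1 ?_
    simp only [ha, hc]
    rw [← L2.inner_indicatorConstLp_one (𝕜 := ℝ) (measurableSet_gridCell j.1 j.2)
      (measure_ne_top _ _)]
    refine (abs_real_inner_le_norm _ _).trans ?_
    exact mul_le_mul_of_nonneg_left ((norm_jetSpace_fst_le _).trans (hB n)) (norm_nonneg _)
  obtain ⟨b, -, φ, hφ, hlim⟩ :=
    (isCompact_univ_pi fun j => isCompact_Icc (a := -c j) (b := c j)).isSeqCompact hac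
  rw [tendsto_pi_nhds] at hlim
  refine ⟨φ, hφ, cauchySeq_tendsto_of_complete ?_⟩
  rw [cauchySeq_iff_tendsto_dist_atTop_0]
  refine Metric.tendsto_nhds.2 fun ε hε => ?_
  have hsmall : Tendsto (fun N : ℕ => 2 * (2 / ((N : ℝ) + 1)) ^ 2 * (2 * B) ^ 2) atTop (𝓝 0) := by
    have h1 : Tendsto (fun N : ℕ => 2 / ((N : ℝ) + 1)) atTop (𝓝 0) :=
      tendsto_const_div_atTop_nhds_zero_nat 2 |>.comp (tendsto_add_atTop_nat 1) |>.congr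
        fun N => by simp
    simpa using ((h1.pow 2).const_mul 2).mul_const ((2 * B) ^ 2)
  obtain ⟨N, hN⟩ := (hsmall.eventually_lt_const (by positivity : 0 < ε ^ 2 / 2)).exists
  obtain ⟨F, hF⟩ := exists_finset_gridCell_cover hΩb N
  have hsum : Tendsto (fun n : ℕ × ℕ => ∑ k ∈ F, (volume.real (gridCell N k ∩ Ω))⁻¹ *
      (a (φ n.1) (N, k) - a (φ n.2) (N, k)) ^ 2) atTop (𝓝 0) := by
    have : (0 : ℝ) = ∑ k ∈ F, (volume.real (gridCell N k ∩ Ω))⁻¹ *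
      (b (N, k) - b (N, k)) ^ 2 := by simp
    rw [this]
    refine tendsto_finsetSum _ fun k _ => Tendsto.const_mul _ (Tendsto.pow ?_ 2)
    rw [← prod_atTop_atTop_eq]
    exact ((hlim (N, k)).comp tendsto_fst).sub ((hlim (N, k)).comp tendsto_snd)
  filter_upwards [hsum.eventually_lt_const (by positivity : 0 < ε ^ 2 / 2)] with n hn
  rw [Real.dist_0_eq_abs, abs_of_nonneg dist_nonneg, dist_eq_norm]
  have hbound := norm_fst_sq_le_sum_cells hΩo hΩb hΩc F (measurableSet_gridCell N)
    (convex_gridCell N) (pairwise_disjoint_gridCell N)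
    (fun k _ x hx y hy => norm_sub_le_of_mem_gridCell hx.1 hy.1) hF
    (q (φ n.1) - q (φ n.2)) ((traceGraph Ω).sub_mem (hq _) (hq _))
  have hint : ∀ k, ∫ x in gridCell N k, (q (φ n.1) - q (φ n.2)).1.fst x ∂(volume.restrict Ω) =
      a (φ n.1) (N, k) - a (φ n.2) (N, k) := by
    intro k
    simp only [ha]
    have e := fun f : Lp ℝ 2 (volume.restrict Ω) => L2.inner_indicatorConstLp_one (𝕜 := ℝ)
      (measurableSet_gridCell N k) (measure_ne_top (volume.restrict Ω) _) f
    rw [← e, ← e, ← e, ← inner_sub_right]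
    rfl
  simp_rw [hint] at hbound
  have hsnd : ‖(q (φ n.1) - q (φ n.2)).1.snd‖ ≤ 2 * B := by
    refine (norm_jetSpace_snd_le _).trans ((norm_sub_le _ _).trans ?_)
    linarith [hB (φ n.1), hB (φ n.2)]
  have hsnd2 : 2 * (2 / ((N : ℝ) + 1)) ^ 2 * ‖(q (φ n.1) - q (φ n.2)).1.snd‖ ^ 2 ≤
      2 * (2 / ((N : ℝ) + 1)) ^ 2 * (2 * B) ^ 2 := by gcongr
  refine lt_of_pow_lt_pow_left₀ 2 hε.le ?_
  have hfst : ‖(q (φ n.1)).1.fst - (q (φ n.2)).1.fst‖ = ‖(q (φ n.1) - q (φ n.2)).1.fst‖ := rfl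
  rw [hfst]
  linarith

theorem exists_const_one_mem_traceGraph {Ω : Set Plane} (hΩb : Bornology.IsBounded Ω)
    (hfin : (μH[1] : Measure Plane) (frontier Ω) < ⊤) :
    ∃ q ∈ traceGraph Ω, q.1.fst =ᵐ[volume.restrict Ω] (fun _ => (1 : ℝ)) ∧ q.1.snd = 0 ∧
      q.2 =ᵐ[(μH[1] : Measure Plane).restrict (frontier Ω)] fun _ => (1 : ℝ) := by
  have : IsFiniteMeasure (volume.restrict Ω) := ⟨by simpa using hΩb.measure_lt_top⟩
  have : IsFiniteMeasure ((μH[1] : Measure Plane).restrict (frontier Ω)) := ⟨by simpa using hfin⟩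
  have m1 : MemLp (fun _ : Plane => (1 : ℝ)) 2 (volume.restrict Ω) := memLp_const 1
  have m2 : MemLp (fun _ : Plane => (1 : ℝ)) 2
    ((μH[1] : Measure Plane).restrict (frontier Ω)) := memLp_const 1
  refine ⟨(WithLp.toLp 2 (m1.toLp _, 0), m2.toLp _), ?_, m1.coeFn_toLp, rfl, m2.coeFn_toLp⟩
  refine Submodule.le_topologicalClosure _ ⟨fun _ => 1, contDiff_const, m1.coeFn_toLp, ?_,
    m2.coeFn_toLp⟩
  have : gradient (fun _ : Plane => (1 : ℝ)) = 0 := by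
    ext1 x; exact gradient_const (F := Plane) x 1
  rw [this]
  exact Lp.coeFn_zero ..

/-- Restriction of boundary values to a part `S` of the boundary. -/
noncomputable abbrev boundaryRestrict (Ω S : Set Plane) :
    BoundaryL2 Ω →L[ℝ] Lp ℝ 2 (((μH[1] : Measure Plane).restrict (frontier Ω)).restrict S) :=
  LpToLpRestrictCLM Plane ℝ ℝ _ 2 S

/-- The Friedrichs inequality for functions vanishing on a part of the boundary of positive length.
Subtracting the mean value `t` leaves a function controlled by its gradient, hence with controlled
trace; on `S` that trace is the constant `-t`, which bounds `t`. -/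
theorem exists_norm_fst_le_norm_snd {Ω S : Set Plane} (hΩo : IsOpen Ω)
    (hΩb : Bornology.IsBounded Ω) (hΩc : Convex ℝ Ω) (hΩn : Ω.Nonempty)
    (hS : S ⊆ frontier Ω) (hSpos : 0 < (μH[1] : Measure Plane) S) :
    ∃ C : ℝ, 0 ≤ C ∧ ∀ q ∈ traceGraph Ω, boundaryRestrict Ω S q.2 = 0 →
      ‖q.1.fst‖ ≤ C * ‖q.1.snd‖ := by
  have hfin := (exists_trace_bound hΩo hΩb hΩc hΩn).1
  obtain ⟨C, hC0, hC⟩ := exists_norm_trace_le hΩo hΩb hΩc hΩn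
  obtain ⟨e, heT, he1, he2, he3⟩ := exists_const_one_mem_traceGraph hΩb hfin
  obtain ⟨h, hh⟩ := Metric.isBounded_iff.1 hΩb
  set R := boundaryRestrict Ω S
  have : IsFiniteMeasure (volume.restrict Ω) := ⟨by simpa using hΩb.measure_lt_top⟩
  have hRe : 0 < ‖R e.2‖ := by
    refine norm_pos_iff.2 fun h0 => hSpos.ne' ?_
    have h1 : R e.2 =ᵐ[((μH[1] : Measure Plane).restrict (frontier Ω)).restrict S] e.2 :=
      LpToLpRestrictCLM_coeFn ℝ S e.2
    have h2 := ae_restrict_of_ae (s := S) he3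
    have h3 : ∀ᵐ x ∂((μH[1] : Measure Plane).restrict (frontier Ω)).restrict S, False := by
      filter_upwards [h1, h2, (h0 ▸ Lp.coeFn_zero ..
        : R e.2 =ᵐ[((μH[1] : Measure Plane).restrict (frontier Ω)).restrict S] 0)] with x a b c
      rw [← a, c] at b
      exact zero_ne_one b
    rw [ae_iff, Measure.restrict_restrict_of_subset hS] at h3
    simpa using h3
  have hvol : 0 < volume.real Ω :=
    ENNReal.toReal_pos (hΩo.measure_pos volume hΩn).ne' hΩb.measure_lt_top.ne
  have hh0 : 0 ≤ h := by
    obtain ⟨x, hx⟩ := hΩn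
    exact dist_nonneg.trans (hh hx hx)
  refine ⟨2 * h + ‖R‖ * (C * (2 * h + 1)) / ‖R e.2‖ * ‖e.1.fst‖, by positivity,
    fun q hq hq0 => ?_⟩
  set s := ‖q.1.snd‖ with hs
  set t : ℝ := (∫ x, q.1.fst x ∂(volume.restrict Ω)) / volume.real Ω with ht
  set p := q - t • e with hp
  have hpT : p ∈ traceGraph Ω := (traceGraph Ω).sub_mem hq ((traceGraph Ω).smul_mem t heT)
  have hpsnd : p.1.snd = q.1.snd := by
    have : p.1.snd = q.1.snd - t • e.1.snd := rfl
    rw [this, he2, smul_zero, sub_zero]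
  have hpfst : p.1.fst = q.1.fst - t • e.1.fst := rfl
  have hmean : ∫ x, p.1.fst x ∂(volume.restrict Ω) = 0 := by
    have i1 : Integrable (q.1.fst : Plane → ℝ) (volume.restrict Ω) :=
      (Lp.memLp q.1.fst).integrable one_le_two
    have h1 : ∫ x, p.1.fst x ∂(volume.restrict Ω) =
        ∫ x, (q.1.fst x - t) ∂(volume.restrict Ω) := by
      refine integral_congr_ae ?_
      rw [hpfst]
      filter_upwards [Lp.coeFn_sub q.1.fst (t • e.1.fst), Lp.coeFn_smul t e.1.fst, he1]
        with x a b c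
      rw [a, Pi.sub_apply, b, Pi.smul_apply, c, smul_eq_mul, mul_one]
    rw [h1, integral_sub i1 (integrable_const t), integral_const, smul_eq_mul,
      measureReal_restrict_apply_univ, ht, mul_div_cancel₀ _ hvol.ne', sub_self]
  have hw : ‖p.1.fst‖ ≤ 2 * h * s := by
    have h1 := norm_fst_sq_le_sum_cells hΩo hΩb hΩc (Finset.univ : Finset Unit)
      (cell := fun _ => univ) (fun _ => MeasurableSet.univ) (fun _ => convex_univ)
      (fun i j hij => (hij rfl).elim) (h := h)
      (fun _ _ x hx y hy => by rw [← dist_eq_norm]; exact hh hy.2 hx.2) (fun x _ => by simp) p hpT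
    simp only [Measure.restrict_univ, hmean, hpsnd, ← hs] at h1
    refine le_of_sq_le_sq ?_ (by positivity)
    simp only [Finset.univ_unique, Finset.sum_singleton] at h1
    nlinarith [mul_nonneg (sq_nonneg h) (sq_nonneg s)]
  have hpn : ‖p.1‖ ≤ (2 * h + 1) * s := by
    have h1 := jetSpace_norm_sq p.1
    rw [hpsnd, ← hs] at h1
    have hs0 : 0 ≤ s := norm_nonneg _
    refine le_of_sq_le_sq ?_ (by positivity)
    have := pow_le_pow_left₀ (norm_nonneg _) hw 2
    nlinarith [mul_nonneg hh0 (sq_nonneg s)]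
  have hRt : |t| * ‖R e.2‖ ≤ ‖R‖ * (C * ((2 * h + 1) * s)) := by
    have h1 : R p.2 = -(t • R e.2) := by
      have : p.2 = q.2 - t • e.2 := rfl
      rw [this, map_sub, map_smul, hq0, zero_sub]
    have h2 : ‖R p.2‖ = |t| * ‖R e.2‖ := by rw [h1, norm_neg, norm_smul, Real.norm_eq_abs]
    rw [← h2]
    refine (R.le_opNorm _).trans ?_
    gcongr
    refine (hC p hpT).trans ?_
    gcongr
  have htb : |t| ≤ ‖R‖ * (C * (2 * h + 1)) / ‖R e.2‖ * s := by
    rw [div_mul_eq_mul_div, le_div_iff₀ hRe]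
    linarith
  have hq1 : q.1.fst = p.1.fst + t • e.1.fst := by rw [hpfst, sub_add_cancel]
  calc ‖q.1.fst‖ ≤ ‖p.1.fst‖ + |t| * ‖e.1.fst‖ := by
        rw [hq1]
        refine (norm_add_le _ _).trans ?_
        rw [norm_smul, Real.norm_eq_abs]
    _ ≤ 2 * h * s + ‖R‖ * (C * (2 * h + 1)) / ‖R e.2‖ * s * ‖e.1.fst‖ := by gcongr
    _ = _ := by ring

/-! ### The admissible set -/

/-- The pairs `(w, ∇w)` of functions whose trace vanishes on `S`. -/
noncomputable def zeroTrace (Ω S : Set Plane) : Submodule ℝ (JetSpace Ω) :=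
  (traceGraph Ω ⊓ LinearMap.ker ((boundaryRestrict Ω S).toLinearMap ∘ₗ
    LinearMap.snd ℝ (JetSpace Ω) (BoundaryL2 Ω))).map
      (LinearMap.fst ℝ (JetSpace Ω) (BoundaryL2 Ω))

theorem mem_zeroTrace {Ω S : Set Plane} {p : JetSpace Ω} :
    p ∈ zeroTrace Ω S ↔ ∃ g, (p, g) ∈ traceGraph Ω ∧ boundaryRestrict Ω S g = 0 := by
  simp [zeroTrace, Submodule.mem_map]

/-- By the trace inequality, the traces of a convergent sequence form a Cauchy sequence. -/
theorem isClosed_zeroTrace {Ω : Set Plane} (S : Set Plane) (hΩo : IsOpen Ω)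
    (hΩb : Bornology.IsBounded Ω) (hΩc : Convex ℝ Ω) (hΩn : Ω.Nonempty) :
    IsClosed (zeroTrace Ω S : Set (JetSpace Ω)) := by
  obtain ⟨C, hC0, hC⟩ := exists_norm_trace_le hΩo hΩb hΩc hΩn
  refine isClosed_of_closure_subset fun p hp => ?_
  rw [mem_closure_iff_seq_limit] at hp
  obtain ⟨x, hx, hlim⟩ := hp
  choose g hgT hg0 using fun n => mem_zeroTrace.1 (hx n)
  have hcau : CauchySeq g := by
    rw [cauchySeq_iff_tendsto_dist_atTop_0]
    have h1 : Tendsto (fun n : ℕ × ℕ => C * dist (x n.1) (x n.2)) atTop (𝓝 (C * 0)) :=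
      (cauchySeq_iff_tendsto_dist_atTop_0.1 hlim.cauchySeq).const_mul C
    rw [mul_zero] at h1
    refine squeeze_zero (fun _ => dist_nonneg) (fun n => ?_) h1
    rw [dist_eq_norm, dist_eq_norm]
    exact hC ((x n.1, g n.1) - (x n.2, g n.2)) ((traceGraph Ω).sub_mem (hgT n.1) (hgT n.2))
  obtain ⟨γ, hγ⟩ := cauchySeq_tendsto_of_complete hcau
  refine mem_zeroTrace.2 ⟨γ, ?_, ?_⟩
  · exact (Submodule.isClosed_topologicalClosure (smoothTraceGraph Ω)).mem_of_tendsto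
      (hlim.prodMk_nhds hγ) (Eventually.of_forall hgT)
  · refine tendsto_nhds_unique (((boundaryRestrict Ω S).continuous.tendsto γ).comp hγ) ?_
    exact tendsto_const_nhds.congr fun n => (hg0 n).symm

theorem isClosed_H1 (Ω : Set Plane) : IsClosed (H1 Ω : Set (JetSpace Ω)) := by
  have heq : (H1 Ω : Set (JetSpace Ω)) = ⋂ (φ : Plane → ℝ) (_ : ContDiff ℝ ∞ φ)
      (_ : HasCompactSupport φ) (_ : tsupport φ ⊆ Ω) (e : Plane), {p : JetSpace Ω |
        ∫ x in Ω, p.fst x * fderiv ℝ φ x e = -∫ x in Ω, inner ℝ (p.snd x) e * φ x} := by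
    ext p
    simp only [mem_iInter]
    rfl
  rw [heq]
  refine isClosed_iInter fun φ => isClosed_iInter fun hφ => isClosed_iInter fun hc =>
    isClosed_iInter fun _ => isClosed_iInter fun e => ?_
  have m1 : MemLp (fun x => fderiv ℝ φ x e) 2 (volume.restrict Ω) :=
    ((continuous_fderiv_test hφ e).memLp_of_hasCompactSupport (p := 2) (μ := volume)
      (hasCompactSupport_fderiv_test hc e)).restrict Ω
  have m2 : MemLp (fun x => φ x • e) 2 (volume.restrict Ω) :=
    ((hφ.continuous.smul continuous_const).memLp_of_hasCompactSupport (p := 2) (μ := volume)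
      (hc.smul_right (f' := fun _ => e))).restrict Ω
  have e1 : ∀ p : JetSpace Ω, ∫ x in Ω, p.fst x * fderiv ℝ φ x e =
      inner ℝ p.fst (m1.toLp _) := fun p => by
    rw [L2.inner_def]
    refine integral_congr_ae ?_
    filter_upwards [m1.coeFn_toLp] with x hx
    rw [hx]
    simp [mul_comm]
  have e2 : ∀ p : JetSpace Ω, ∫ x in Ω, inner ℝ (p.snd x) e * φ x =
      inner ℝ p.snd (m2.toLp _) := fun p => by
    rw [L2.inner_def]
    refine integral_congr_ae ?_
    filter_upwards [m2.coeFn_toLp] with x hx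
    rw [hx, real_inner_smul_right, mul_comm]
  simp_rw [e1, e2]
  exact isClosed_eq (continuous_jetSpace_fst.inner continuous_const)
    (continuous_jetSpace_snd.inner continuous_const).neg

theorem sub_mem_zeroTrace_of_mem_admissible {Ω S : Set Plane} (hΩo : IsOpen Ω)
    (hΩb : Bornology.IsBounded Ω) (hfin : (μH[1] : Measure Plane) (frontier Ω) < ⊤)
    (hS : S ⊆ frontier Ω) {u₀ v : H1 Ω} (hv : v ∈ admissible Ω S u₀) :
    v.1 - u₀.1 ∈ zeroTrace Ω S := by
  obtain ⟨g, g₀, hg, hg₀, hgg⟩ := hv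
  refine mem_zeroTrace.2 ⟨hg.1.toLp g - hg₀.1.toLp g₀, (traceGraph Ω).sub_mem
    (mem_traceGraph_of_isTrace hΩo hΩb hfin hg) (mem_traceGraph_of_isTrace hΩo hΩb hfin hg₀), ?_⟩
  rw [← Measure.restrict_restrict_of_subset hS] at hgg
  refine Lp.eq_zero_iff_ae_eq_zero.2 ?_
  filter_upwards [LpToLpRestrictCLM_coeFn ℝ S (hg.1.toLp g - hg₀.1.toLp g₀),
    ae_restrict_of_ae (s := S) (Lp.coeFn_sub (hg.1.toLp g) (hg₀.1.toLp g₀)),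
    ae_restrict_of_ae (s := S) hg.1.coeFn_toLp, ae_restrict_of_ae (s := S) hg₀.1.coeFn_toLp, hgg]
    with x a b c d h
  rw [a, b, Pi.sub_apply, c, d, h, sub_self]
  rfl

theorem mem_admissible_of_sub_mem_zeroTrace {Ω S : Set Plane} (hΩo : IsOpen Ω)
    (hΩb : Bornology.IsBounded Ω) (hfin : (μH[1] : Measure Plane) (frontier Ω) < ⊤)
    (hS : S ⊆ frontier Ω) {u₀ v w : H1 Ω} (hw : w ∈ admissible Ω S u₀)
    (hv : v.1 - u₀.1 ∈ zeroTrace Ω S) : v ∈ admissible Ω S u₀ := by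
  obtain ⟨-, g₀, -, hg₀, -⟩ := hw
  obtain ⟨g, hgT, hg⟩ := mem_zeroTrace.1 hv
  have hT₀ := mem_traceGraph_of_isTrace hΩo hΩb hfin hg₀
  have hT : (v.1, hg₀.1.toLp g₀ + g) ∈ traceGraph Ω := by
    have h : ((u₀.1, hg₀.1.toLp g₀) + (v.1 - u₀.1, g) : JetSpace Ω × BoundaryL2 Ω) =
      (v.1, hg₀.1.toLp g₀ + g) := Prod.ext (add_sub_cancel _ _) rfl
    exact h ▸ (traceGraph Ω).add_mem hT₀ hgT
  refine ⟨_, _, isTrace_of_mem_traceGraph hT, isTrace_of_mem_traceGraph hT₀, ?_⟩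
  rw [← Measure.restrict_restrict_of_subset hS]
  filter_upwards [LpToLpRestrictCLM_coeFn ℝ S g, Lp.eq_zero_iff_ae_eq_zero.1 hg,
    ae_restrict_of_ae (s := S) (Lp.coeFn_add (hg₀.1.toLp g₀) g)] with x a b c
  rw [c, Pi.add_apply, ← a, b]
  simp

/-! ### Phase functions and potential energies -/

theorem IsTransitionLayer.monotone {lam₁ lam₂ : ℝ} {φ₁ : ℝ → ℝ}
    (hφ : IsTransitionLayer lam₁ lam₂ φ₁) : Monotone φ₁ :=
  monotone_of_deriv_nonneg (hφ.contDiff.differentiable one_ne_zero) hφ.deriv_nonneg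

theorem IsTransitionLayer.sq_le {lam₁ lam₂ : ℝ} {φ₁ : ℝ → ℝ}
    (hφ : IsTransitionLayer lam₁ lam₂ φ₁) (t : ℝ) : lam₂ ^ 2 ≤ φ₁ t := by
  rw [← hφ.eq_of_nonpos (min t 0) (min_le_right _ _)]
  exact hφ.monotone (min_le_left _ _)

theorem IsTransitionLayer.le_sq {lam₁ lam₂ : ℝ} {φ₁ : ℝ → ℝ}
    (hφ : IsTransitionLayer lam₁ lam₂ φ₁) (t : ℝ) : φ₁ t ≤ lam₁ ^ 2 := by
  rw [← hφ.eq_of_one_le (max t 1) (le_max_right _ _)]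
  exact hφ.monotone (le_max_left _ _)

theorem IsTransitionLayer.le_phase_sq {lam₁ lam₂ : ℝ} {φ₁ : ℝ → ℝ}
    (hφ : IsTransitionLayer lam₁ lam₂ φ₁) {ε : ℝ} (hε : 0 < ε) (t : ℝ) :
    φ₁ (t / ε) ≤ phase lam₁ lam₂ t ^ 2 := by
  unfold phase
  split_ifs with ht
  · exact hφ.le_sq _
  · exact (hφ.eq_of_nonpos _ (div_nonpos_of_nonpos_of_nonneg (not_lt.1 ht) hε.le)).le

theorem IsTransitionLayer.anti_scale {lam₁ lam₂ : ℝ} {φ₁ : ℝ → ℝ}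
    (hφ : IsTransitionLayer lam₁ lam₂ φ₁) {ε ε' : ℝ} (hε : 0 < ε) (h : ε ≤ ε') (t : ℝ) :
    φ₁ (t / ε') ≤ φ₁ (t / ε) := by
  rcases le_total 0 t with ht | ht
  · exact hφ.monotone (by gcongr)
  · rw [hφ.eq_of_nonpos _ (div_nonpos_of_nonpos_of_nonneg ht (hε.trans_le h).le)]
    exact hφ.sq_le _

/-- The relaxed phase dominates the sharp one in the limit. The minimum is needed where `t = 0`: there
the relaxed phase need not converge, but it stays above the sharp value `lam₂²`. -/
theorem IsTransitionLayer.tendsto_min {lam₁ lam₂ : ℝ} {φ₁ : ℝ → ℝ}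
    (hφ : IsTransitionLayer lam₁ lam₂ φ₁) {ε a : ℕ → ℝ} {t : ℝ} (hεpos : ∀ k, 0 < ε k)
    (hε : Tendsto ε atTop (𝓝 0)) (ha : Tendsto a atTop (𝓝 t)) :
    Tendsto (fun k => min (φ₁ (a k / ε k)) (phase lam₁ lam₂ t ^ 2)) atTop
      (𝓝 (phase lam₁ lam₂ t ^ 2)) := by
  refine tendsto_const_nhds.congr' ?_
  unfold phase
  split_ifs with ht
  · filter_upwards [ha.eventually_const_lt (half_lt_self ht),
      hε.eventually_lt_const (half_pos ht)] with k h1 h2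
    rw [hφ.eq_of_one_le _ ((one_le_div (hεpos k)).2 (h2.trans h1).le), min_self]
  · exact Eventually.of_forall fun k => (min_eq_right (hφ.sq_le _)).symm

theorem measurable_phase (lam₁ lam₂ : ℝ) : Measurable (phase lam₁ lam₂) :=
  Measurable.ite measurableSet_Ioi measurable_const measurable_const

theorem abs_phase_sq_le {lam₁ lam₂ : ℝ} (h₂ : 0 < lam₂) (h : lam₂ < lam₁) (t : ℝ) :
    |phase lam₁ lam₂ t ^ 2| ≤ lam₁ ^ 2 := by
  rw [abs_of_nonneg (sq_nonneg _)]
  unfold phase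
  split_ifs
  · exact le_rfl
  · exact pow_le_pow_left₀ h₂.le h.le 2

theorem integrable_weight_mul {Ω : Set Plane} (hΩb : Bornology.IsBounded Ω) {Q : Plane → ℝ}
    (hQ : AEMeasurable Q (volume.restrict Ω)) {m M : ℝ} (hm : 0 < m)
    (hQb : ∀ᵐ x ∂volume.restrict Ω, m ≤ Q x ∧ Q x ≤ M) {F : Plane → ℝ}
    (hF : AEMeasurable F (volume.restrict Ω)) {c : ℝ} (hc : ∀ x, |F x| ≤ c) :
    Integrable (fun x => Q x ^ 2 * F x) (volume.restrict Ω) ∧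
      ∀ᵐ x ∂volume.restrict Ω, ‖Q x ^ 2 * F x‖ ≤ M ^ 2 * c := by
  have : IsFiniteMeasure (volume.restrict Ω) := ⟨by simpa using hΩb.measure_lt_top⟩
  have hb : ∀ᵐ x ∂volume.restrict Ω, ‖Q x ^ 2 * F x‖ ≤ M ^ 2 * c := by
    filter_upwards [hQb] with x hx
    rw [norm_mul, Real.norm_eq_abs, Real.norm_eq_abs, abs_of_nonneg (sq_nonneg _)]
    have := pow_le_pow_left₀ (hm.le.trans hx.1) hx.2 2
    exact mul_le_mul this (hc x) (abs_nonneg _) (sq_nonneg _)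
  exact ⟨Integrable.of_bound ((hQ.pow_const 2).mul hF).aestronglyMeasurable _ hb, hb⟩

theorem integral_grad_sq_add {Ω : Set Plane} (v : H1 Ω) {f : Plane → ℝ}
    (hf : Integrable f (volume.restrict Ω)) :
    ∫ x in Ω, (‖H1.grad v x‖ ^ 2 + f x) = ‖v.1.snd‖ ^ 2 + ∫ x in Ω, f x := by
  have h1 : Integrable (fun x => ‖H1.grad v x‖ ^ 2) (volume.restrict Ω) :=
    (Lp.memLp (H1.grad v)).norm.integrable_sq
  rw [integral_add h1 hf, L2_norm_sq_eq_integral]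
  rfl

/-! ### Compactness of admissible sequences and the limit of minimizers -/

theorem exists_norm_le_of_mem_zeroTrace {Ω S : Set Plane} (hΩo : IsOpen Ω)
    (hΩb : Bornology.IsBounded Ω) (hΩc : Convex ℝ Ω) (hΩn : Ω.Nonempty)
    (hS : S ⊆ frontier Ω) (hSpos : 0 < (μH[1] : Measure Plane) S) :
    ∃ C : ℝ, 0 ≤ C ∧ ∀ p ∈ zeroTrace Ω S, ‖p‖ ≤ C * ‖p.snd‖ := by
  obtain ⟨C, hC0, hC⟩ := exists_norm_fst_le_norm_snd hΩo hΩb hΩc hΩn hS hSpos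
  refine ⟨C + 1, by positivity, fun p hp => ?_⟩
  obtain ⟨g, hgT, hg0⟩ := mem_zeroTrace.1 hp
  have h1 : ‖p.fst‖ ≤ C * ‖p.snd‖ := hC (p, g) hgT hg0
  have h2 : ‖p‖ ≤ ‖p.fst‖ + ‖p.snd‖ := by
    refine le_of_sq_le_sq ?_ (by positivity)
    rw [jetSpace_norm_sq]
    nlinarith [mul_nonneg (norm_nonneg p.fst) (norm_nonneg p.snd)]
  linarith

theorem jetSpace_sub_fst_add {Ω : Set Plane} (p q : JetSpace Ω) :
    (p - q).fst + q.fst = p.fst := by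
  rw [WithLp.sub_fst, sub_add_cancel]

theorem exists_subseq_tendsto_fst_of_sub_mem {Ω S : Set Plane} (hΩo : IsOpen Ω)
    (hΩb : Bornology.IsBounded Ω) (hΩc : Convex ℝ Ω) {w : ℕ → JetSpace Ω} {p : JetSpace Ω}
    (hw : ∀ k, w k - p ∈ zeroTrace Ω S) {B : ℝ} (hB : ∀ k, ‖w k - p‖ ≤ B) :
    ∃ n : ℕ → ℕ, StrictMono n ∧ ∃ f : Lp ℝ 2 (volume.restrict Ω),
      Tendsto (fun k => (w (n k)).fst) atTop (𝓝 f) := by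
  choose g hg _ using fun k => mem_zeroTrace.1 (hw k)
  obtain ⟨n, hn, f, hf⟩ := exists_subseq_tendsto_fst hΩo hΩb hΩc
    (q := fun k => (w k - p, g k)) hg hB
  refine ⟨n, hn, f + p.fst, (hf.add_const p.fst).congr fun k => ?_⟩
  exact jetSpace_sub_fst_add (w (n k)) p

theorem exists_subseq_tendsto_ae_of_sub_mem {Ω S : Set Plane} (hΩo : IsOpen Ω)
    (hΩb : Bornology.IsBounded Ω) (hΩc : Convex ℝ Ω) {w : ℕ → JetSpace Ω} {p : JetSpace Ω}
    (hw : ∀ k, w k - p ∈ zeroTrace Ω S) {B : ℝ} (hB : ∀ k, ‖w k - p‖ ≤ B)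
    {A : ℝ} (hA : ∀ k, ‖(w k).snd‖ ≤ A) :
    ∃ (n : ℕ → ℕ) (f : Lp ℝ 2 (volume.restrict Ω)) (ℓ : ℝ), StrictMono n ∧
      Tendsto (fun k => (w (n k)).fst) atTop (𝓝 f) ∧
      (∀ᵐ x ∂volume.restrict Ω, Tendsto (fun k => (w (n k)).fst x) atTop (𝓝 (f x))) ∧
      Tendsto (fun k => ‖(w (n k)).snd‖) atTop (𝓝 ℓ) := by
  obtain ⟨n₁, hn₁, f, hf⟩ := exists_subseq_tendsto_fst_of_sub_mem hΩo hΩb hΩc hw hB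
  obtain ⟨n₂, hn₂, hae⟩ := (tendstoInMeasure_of_tendsto_Lp hf).exists_seq_tendsto_ae
  obtain ⟨ℓ, -, n₃, hn₃, hℓ⟩ := isCompact_Icc.tendsto_subseq (x := fun k =>
    ‖(w (n₁ (n₂ k))).snd‖) (fun k => ⟨norm_nonneg _, hA _⟩)
  refine ⟨fun k => n₁ (n₂ (n₃ k)), f, ℓ, hn₁.comp (hn₂.comp hn₃),
    hf.comp (hn₂.comp hn₃).tendsto_atTop, ?_, hℓ⟩
  filter_upwards [hae] with x hx
  exact hx.comp hn₃.tendsto_atTop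

theorem tendsto_norm_jetSpace {Ω : Set Plane} {w : ℕ → JetSpace Ω} {p : JetSpace Ω}
    (h1 : Tendsto (fun k => ‖(w k).fst‖) atTop (𝓝 ‖p.fst‖))
    (h2 : Tendsto (fun k => ‖(w k).snd‖) atTop (𝓝 ‖p.snd‖)) :
    Tendsto (fun k => ‖w k‖) atTop (𝓝 ‖p‖) := by
  have h := ((h1.pow 2).add (h2.pow 2)).sqrt
  rw [← jetSpace_norm_sq, Real.sqrt_sq (norm_nonneg _)] at h
  refine h.congr fun k => ?_
  rw [← jetSpace_norm_sq, Real.sqrt_sq (norm_nonneg _)]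

/-- Passage to the limit in a closed convex set, given strong convergence of the functions and
convergence of the norms of the gradients. -/
theorem exists_limit_mem_of_isClosed_convex {Ω : Set Plane} {Z : Set (JetSpace Ω)}
    (hZ : IsClosed Z) (hZc : Convex ℝ Z) {w : ℕ → JetSpace Ω} (hw : ∀ k, w k ∈ Z) {B : ℝ}
    (hB : ∀ k, ‖w k‖ ≤ B) {f : Lp ℝ 2 (volume.restrict Ω)} {ℓ : ℝ}
    (hf : Tendsto (fun k => (w k).fst) atTop (𝓝 f))
    (hℓ : Tendsto (fun k => ‖(w k).snd‖) atTop (𝓝 ℓ)) :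
    ∃ c ∈ Z, c.fst = f ∧ ‖c.snd‖ ≤ ℓ ∧ (‖c.snd‖ = ℓ → Tendsto w atTop (𝓝 c)) := by
  refine (exists_mem_closure_convexHull_tails w hB).elim fun c hc => ?_
  have hcf : c.fst = f := by
    refine eq_of_forall_dist_le fun η hη => ?_
    refine mem_of_mem_closure_convexHull_tails hc.1
      (Z := (fun p : JetSpace Ω => p.fst) ⁻¹' Metric.closedBall f η)
      (Metric.isClosed_closedBall.preimage continuous_jetSpace_fst)
      ((convex_closedBall f η).is_linear_preimage ⟨fun _ _ => rfl, fun _ _ => rfl⟩) ?_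
    exact hf.eventually_mem (Metric.closedBall_mem_nhds f hη)
  refine ⟨c, mem_of_mem_closure_convexHull_tails hc.1 hZ hZc (Eventually.of_forall hw), hcf, ?_,
    fun heq => hc.2 (tendsto_norm_jetSpace ?_ (heq ▸ hℓ))⟩
  · refine le_of_forall_pos_le_add fun η hη => ?_
    have h := mem_of_mem_closure_convexHull_tails hc.1
      (Z := (fun p : JetSpace Ω => p.snd) ⁻¹' Metric.closedBall 0 (ℓ + η))
      (Metric.isClosed_closedBall.preimage continuous_jetSpace_snd)
      ((convex_closedBall 0 (ℓ + η)).is_linear_preimage ⟨fun _ _ => rfl, fun _ _ => rfl⟩) ?_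
    · simpa using h
    · filter_upwards [hℓ.eventually_lt_const (lt_add_of_pos_right ℓ hη)] with k hk
      simpa using hk.le
  · rw [hcf]
    exact hf.norm

/-- Compactness of gradient-bounded sequences of admissible functions: strong convergence in
`H¹(Ω)` of the subsequence only requires that no Dirichlet energy is lost in the limit. -/
theorem exists_subseq_admissible {Ω S : Set Plane} (hΩo : IsOpen Ω)
    (hΩb : Bornology.IsBounded Ω) (hΩc : Convex ℝ Ω) (hΩn : Ω.Nonempty)
    (hS : S ⊆ frontier Ω) (hSpos : 0 < (μH[1] : Measure Plane) S) {u₀ : H1 Ω} {v : ℕ → H1 Ω}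
    (hv : ∀ n, v n ∈ admissible Ω S u₀) {A : ℝ} (hA : ∀ n, ‖(v n).1.snd‖ ≤ A) :
    ∃ (n : ℕ → ℕ) (u : H1 Ω) (ℓ : ℝ), StrictMono n ∧ u ∈ admissible Ω S u₀ ∧
      (∀ᵐ x ∂volume.restrict Ω, Tendsto (fun k => H1.fn (v (n k)) x) atTop (𝓝 (H1.fn u x))) ∧
      Tendsto (fun k => ‖(v (n k)).1.snd‖) atTop (𝓝 ℓ) ∧ ‖u.1.snd‖ ≤ ℓ ∧
      (‖u.1.snd‖ = ℓ → Tendsto (fun k => v (n k)) atTop (𝓝 u)) := by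
  have hfin := (exists_trace_bound hΩo hΩb hΩc hΩn).1
  obtain ⟨C, hC0, hC⟩ := exists_norm_le_of_mem_zeroTrace hΩo hΩb hΩc hΩn hS hSpos
  have hmem : ∀ k, (v k).1 - u₀.1 ∈ zeroTrace Ω S := fun k =>
    sub_mem_zeroTrace_of_mem_admissible hΩo hΩb hfin hS (hv k)
  have hsnd : ∀ k, ‖((v k).1 - u₀.1).snd‖ ≤ A + ‖u₀.1.snd‖ := fun k =>
    (norm_sub_le (v k).1.snd u₀.1.snd).trans (by linarith [hA k])
  have hbd : ∀ k, ‖(v k).1 - u₀.1‖ ≤ C * (A + ‖u₀.1.snd‖) := fun k =>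
    (hC _ (hmem k)).trans (mul_le_mul_of_nonneg_left (hsnd k) hC0)
  obtain ⟨n, f, ℓ, hnmono, hfst, hae, hℓ⟩ :=
    exists_subseq_tendsto_ae_of_sub_mem hΩo hΩb hΩc (w := fun k => (v k).1) hmem hbd hA
  have hvB : ∀ k, ‖(v (n k)).1‖ ≤ C * (A + ‖u₀.1.snd‖) + ‖u₀.1‖ := fun k =>
    (norm_le_norm_sub_add _ _).trans (add_le_add (hbd (n k)) le_rfl)
  have hZ : IsClosed ((H1 Ω : Set (JetSpace Ω)) ∩
      (fun p => p - u₀.1) ⁻¹' (zeroTrace Ω S : Set (JetSpace Ω))) :=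
    (isClosed_H1 Ω).inter
      ((isClosed_zeroTrace S hΩo hΩb hΩc hΩn).preimage (continuous_sub_right u₀.1))
  have hZc : Convex ℝ ((H1 Ω : Set (JetSpace Ω)) ∩
      (fun p => p - u₀.1) ⁻¹' (zeroTrace Ω S : Set (JetSpace Ω))) := by
    simp_rw [sub_eq_add_neg]
    exact (H1 Ω).convex.inter ((zeroTrace Ω S).convex.translate_preimage_left _)
  refine (exists_limit_mem_of_isClosed_convex hZ hZc (w := fun k => (v (n k)).1)
    (fun k => ⟨(v (n k)).2, hmem (n k)⟩) hvB hfst hℓ).elim fun c hc => ?_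
  refine ⟨n, ⟨c, hc.1.1⟩, ℓ, hnmono,
    mem_admissible_of_sub_mem_zeroTrace hΩo hΩb hfin hS (hv 0) hc.1.2, ?_, hℓ, hc.2.2.1,
    fun heq => tendsto_subtype_rng.2 (hc.2.2.2 heq)⟩
  have h1 : H1.fn (⟨c, hc.1.1⟩ : H1 Ω) = f := hc.2.1
  rw [h1]
  exact hae

theorem theorem4p1
    (Ω : Set Plane) (hΩo : IsOpen Ω) (hΩb : Bornology.IsBounded Ω) (hΩc : Convex ℝ Ω)
    (S : Set Plane) (hS : S ⊂ frontier Ω) (hSpos : 0 < (μH[1] : Measure Plane) S)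
    (u₀ : H1 Ω)
    (Q : Plane → ℝ) (hQ : AEMeasurable Q (volume.restrict (closure Ω)))
    (m M : ℝ) (hm : 0 < m)
    (hQb : ∀ᵐ x ∂volume.restrict (closure Ω), m ≤ Q x ∧ Q x ≤ M)
    (lam₁ lam₂ : ℝ) (hlam₂ : 0 < lam₂) (hlam : lam₂ < lam₁)
    (φ₁ : ℝ → ℝ) (hφ₁ : IsTransitionLayer lam₁ lam₂ φ₁)
    (uε : ℝ → H1 Ω)
    (huε : ∀ ε : ℝ, 0 < ε →
      IsMinimizer (relaxedEnergy Ω Q φ₁ ε) (admissible Ω S u₀) (uε ε))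
    (δ : ℕ → ℝ) (hδpos : ∀ n, 0 < δ n) (hδ : Tendsto δ atTop (𝓝 0)) :
    ∃ u : H1 Ω,
      IsMinimizer (energy Ω Q lam₁ lam₂) (admissible Ω S u₀) u ∧
      Tendsto (fun ε => relaxedEnergy Ω Q φ₁ ε (uε ε)) (𝓝[>] 0)
        (𝓝 (energy Ω Q lam₁ lam₂ u)) ∧
      ∃ n : ℕ → ℕ, StrictMono n ∧ Tendsto (fun k => uε (δ (n k))) atTop (𝓝 u) := by
  have hΩn : Ω.Nonempty := by
    by_contra h
    rw [not_nonempty_iff_eq_empty] at h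
    rw [h, frontier_empty] at hS
    rw [subset_empty_iff.1 hS.1, measure_empty] at hSpos
    exact hSpos.false
  have hQ' : AEMeasurable Q (volume.restrict Ω) :=
    hQ.mono_measure (Measure.restrict_mono subset_closure le_rfl)
  have hQb' : ∀ᵐ x ∂volume.restrict Ω, m ≤ Q x ∧ Q x ≤ M :=
    ae_restrict_of_ae_restrict_of_subset subset_closure hQb
  have hint : ∀ {F : Plane → ℝ}, AEMeasurable F (volume.restrict Ω) →
      (∀ x, |F x| ≤ lam₁ ^ 2) → Integrable (fun x => Q x ^ 2 * F x) (volume.restrict Ω) ∧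
      ∀ᵐ x ∂volume.restrict Ω, ‖Q x ^ 2 * F x‖ ≤ M ^ 2 * lam₁ ^ 2 := fun hF hc =>
    integrable_weight_mul hΩb hQ' hm hQb' hF hc
  have hfn : ∀ v : H1 Ω, AEMeasurable (H1.fn v) (volume.restrict Ω) := fun v =>
    (Lp.aestronglyMeasurable _).aemeasurable
  have hφabs : ∀ t, |φ₁ t| ≤ lam₁ ^ 2 := fun t => by
    rw [abs_of_nonneg ((sq_nonneg _).trans (hφ₁.sq_le t))]
    exact hφ₁.le_sq t
  have hφm : ∀ (ε : ℝ) (v : H1 Ω),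
      AEMeasurable (fun x => φ₁ (H1.fn v x / ε)) (volume.restrict Ω) := fun ε v =>
    hφ₁.contDiff.continuous.measurable.comp_aemeasurable ((hfn v).div_const ε)
  have hpm : ∀ v : H1 Ω,
      AEMeasurable (fun x => phase lam₁ lam₂ (H1.fn v x) ^ 2) (volume.restrict Ω) := fun v =>
    ((measurable_phase lam₁ lam₂).comp_aemeasurable (hfn v)).pow_const 2
  have hφi : ∀ (ε : ℝ) (v : H1 Ω), Integrable (fun x => Q x ^ 2 * φ₁ (H1.fn v x / ε))
      (volume.restrict Ω) := fun ε v => (hint (hφm ε v) fun x => hφabs _).1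
  have hpi : ∀ v : H1 Ω, Integrable (fun x => Q x ^ 2 * phase lam₁ lam₂ (H1.fn v x) ^ 2)
      (volume.restrict Ω) := fun v => (hint (hpm v) fun x => abs_phase_sq_le hlam₂ hlam _).1
  have hrel : ∀ ε v, relaxedEnergy Ω Q φ₁ ε v =
      ‖v.1.snd‖ ^ 2 + ∫ x in Ω, Q x ^ 2 * φ₁ (H1.fn v x / ε) := fun ε v =>
    integral_grad_sq_add v (hφi ε v)
  have hen : ∀ v, energy Ω Q lam₁ lam₂ v =
      ‖v.1.snd‖ ^ 2 + ∫ x in Ω, Q x ^ 2 * phase lam₁ lam₂ (H1.fn v x) ^ 2 := fun v =>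
    integral_grad_sq_add v (hpi v)
  have hrel_le : ∀ ε, 0 < ε → ∀ v ∈ admissible Ω S u₀,
      relaxedEnergy Ω Q φ₁ ε (uε ε) ≤ energy Ω Q lam₁ lam₂ v := fun ε hε v hv => by
    refine ((huε ε hε).2 v hv).trans ?_
    rw [hrel, hen]
    exact add_le_add le_rfl <| integral_mono (hφi ε v) (hpi v) fun x =>
      mul_le_mul_of_nonneg_left (hφ₁.le_phase_sq hε _) (sq_nonneg _)
  have hanti : ∀ ε ε', 0 < ε → ε ≤ ε' →
      relaxedEnergy Ω Q φ₁ ε' (uε ε') ≤ relaxedEnergy Ω Q φ₁ ε (uε ε) := fun ε ε' hε h => by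
    refine ((huε ε' (hε.trans_le h)).2 _ (huε ε hε).1).trans ?_
    rw [hrel, hrel]
    exact add_le_add le_rfl <| integral_mono (hφi ε' _) (hφi ε _) fun x =>
      mul_le_mul_of_nonneg_left (hφ₁.anti_scale hε h _) (sq_nonneg _)
  have hpot_nonneg : ∀ (ε : ℝ) (v : H1 Ω), 0 ≤ ∫ x in Ω, Q x ^ 2 * φ₁ (H1.fn v x / ε) := fun ε v =>
    integral_nonneg fun x => mul_nonneg (sq_nonneg _) ((sq_nonneg _).trans (hφ₁.sq_le _))
  have hgrad : ∀ k, ‖(uε (δ k)).1.snd‖ ≤ √(energy Ω Q lam₁ lam₂ (uε 1)) := fun k => by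
    refine Real.le_sqrt_of_sq_le ?_
    have h1 := hrel_le (δ k) (hδpos k) _ (huε 1 one_pos).1
    rw [hrel] at h1
    linarith [hpot_nonneg (δ k) (uε (δ k))]
  obtain ⟨n, u, ℓ, hn, huK, hae, hℓ, huℓ, hstrong⟩ := exists_subseq_admissible hΩo hΩb hΩc hΩn
    hS.1 hSpos (fun k => (huε (δ k) (hδpos k)).1) hgrad
  -- Truncating the relaxed potential at the limiting one turns Fatou's lemma into dominated
  -- convergence.
  obtain ⟨p, hp⟩ : ∃ p : ℕ → Plane → ℝ, p = fun k x =>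
      min (φ₁ (H1.fn (uε (δ (n k))) x / δ (n k))) (phase lam₁ lam₂ (H1.fn u x) ^ 2) := ⟨_, rfl⟩
  obtain ⟨P, hP⟩ : ∃ P, P = ∫ x in Ω, Q x ^ 2 * phase lam₁ lam₂ (H1.fn u x) ^ 2 := ⟨_, rfl⟩
  have hpabs : ∀ k x, |p k x| ≤ lam₁ ^ 2 := fun k x => by
    simp only [hp]
    rw [abs_of_nonneg (le_min ((sq_nonneg _).trans (hφ₁.sq_le _)) (sq_nonneg _))]
    exact (min_le_left _ _).trans (hφ₁.le_sq _)
  have hpk := fun k => hint (F := p k)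
    (hp ▸ (hφm (δ (n k)) (uε (δ (n k)))).min (hpm u)) (hpabs k)
  have hlimP : Tendsto (fun k => ∫ x in Ω, Q x ^ 2 * p k x) atTop (𝓝 P) := by
    have : IsFiniteMeasure (volume.restrict Ω) := ⟨by simpa using hΩb.measure_lt_top⟩
    rw [hP]
    refine tendsto_integral_of_dominated_convergence (fun _ => M ^ 2 * lam₁ ^ 2)
      (fun k => (hpk k).1.aestronglyMeasurable) (integrable_const _) (fun k => (hpk k).2) ?_
    filter_upwards [hae] with x hx
    rw [hp]
    exact (hφ₁.tendsto_min (fun k => hδpos (n k)) (hδ.comp hn.tendsto_atTop) hx).const_mul _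
  have hlow : ∀ k, ‖(uε (δ (n k))).1.snd‖ ^ 2 + ∫ x in Ω, Q x ^ 2 * p k x ≤
      relaxedEnergy Ω Q φ₁ (δ (n k)) (uε (δ (n k))) := fun k => by
    rw [hrel]
    exact add_le_add le_rfl <| integral_mono (hpk k).1 (hφi _ _) fun x => by
      simp only [hp]
      exact mul_le_mul_of_nonneg_left (min_le_left _ _) (sq_nonneg _)
  have hlim : Tendsto (fun k => ‖(uε (δ (n k))).1.snd‖ ^ 2 + ∫ x in Ω, Q x ^ 2 * p k x) atTop
      (𝓝 (ℓ ^ 2 + P)) := (hℓ.pow 2).add hlimP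
  have hmin : ∀ w ∈ admissible Ω S u₀, ℓ ^ 2 + P ≤ energy Ω Q lam₁ lam₂ w := fun w hw =>
    le_of_tendsto hlim (Eventually.of_forall fun k =>
      (hlow k).trans (hrel_le _ (hδpos _) w hw))
  have heq : ‖u.1.snd‖ = ℓ := by
    refine le_antisymm huℓ (le_of_sq_le_sq ?_ (norm_nonneg _))
    have := hmin u huK
    rw [hen, ← hP] at this
    linarith
  have hEu : energy Ω Q lam₁ lam₂ u = ℓ ^ 2 + P := by rw [hen, heq, hP]
  refine ⟨u, ⟨huK, fun w hw => hEu.trans_le (hmin w hw)⟩, ?_, n, hn, hstrong heq⟩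
  rw [← hEu] at hlim
  refine tendsto_order.2 ⟨fun a ha => ?_, fun a ha => ?_⟩
  · obtain ⟨k, hk⟩ := (hlim.eventually_const_lt ha).exists
    filter_upwards [Ioo_mem_nhdsGT (hδpos (n k))] with ε hε
    exact (hk.trans_le (hlow k)).trans_le (hanti ε _ hε.1 hε.2.le)
  · filter_upwards [self_mem_nhdsWithin] with ε hε
    exact (hrel_le ε hε u huK).trans_lt ha
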